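/- Write $\mathbb S^{d-1}$ for the unit sphere of $\mathbb R^d$. A defining function on $\mathbb R^d\times\mathbb S^{d-1}$ is *linear* if $g(x,\theta)=\langle x,\theta\rangle$ and *circular of radius* $r\ge 0$ if $g(x,\theta)=\|x-r\theta\|_2$. Let $p\ge1$ and $c(x,y)=|x-y|$. For probability measures $\mu,\nu$ on $\mathbb R^{d_1}\times\mathbb R^{d_2}$ put $$\mathrm{H2SW}_p(\mu,\nu;c,g_1,g_2)=\Bigl(\mathbb E\bigl[W_p^p\bigl((S_{\theta_1,\theta_2,\psi})_\sharp\mu,(S_{\theta_1,\theta_2,\psi})_\sharp\nu;c\bigr)\bigr]\Bigr)^{1/p},\qquad S_{\theta_1,\theta_2,\psi}(x_1,x_2)=\psi_1g_1(x_1,\theta_1)+\psi_2g_2(x_2,\theta_2),$$ where $(\theta_1,\theta_2,\psi)$ is uniformly distributed on $\mathbb S^{d_1-1}\times\mathbb S^{d_2-1}\times\mathbb S^1$, and, for probability measures $\alpha,\beta$ on $\mathbb R$, $W_p^p(\alpha,\beta;c)=\inf_{\pi}\int c(x,y)^p\,d\pi(x,y)$ over all couplings $\pi$ of $\alpha$ and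 $\beta$. Let $M_k(\mu)=\int (\|x_1\|_2^2+\|x_2\|_2^2)^{k/2}\,d\mu(x_1,x_2)$ be the $k$-th moment. There are a constant $C_{g_1,g_2}\ge 0$ depending only on the defining functions $g_1,g_2$ (each linear, or circular of some radius) and a constant $C_{p,q}\ge 0$ depending only on the real numbers $p\ge 1$ and $q>p$ such that the following holds. Let $d_1,d_2\ge1$, let each of $g_1,g_2$ be linear or circular, let $\mu,\nu$ be probability measures on $\mathbb R^{d_1}\times\mathbb R^{d_2}$ with finite $q$-th moments, and let $n\ge1$, with $n\ge 2$ in the case $q=2p$. Let $\mu_n=\frac1n\sum_{i=1}^n\delta_{X_i}$ and $\nu_n=\frac1n\sum_{i=1}^n\delta_{Y_i}$ be the empirical distributions of i.i.d. samples $X_1,\dots,X_n\sim\mu$ and $Y_1,\dots,Y_n\sim\nu$. Then $\mathrm{H2SW}_p(\mu,\nu;c,g_1,g_2)$ and $\mathrm{H2SW}_p(\mu_n,\nu_n;c,g_1,g_2)$ are finite, and $$\mathbb E\bigl|\mathrm{H2SW}_p(\mu_n,\nu_n;c,g_1,g_2)-\mathrm{H2SW}_p(\mu,\nu;c,g_1,g_2)\bigr|\le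 C_{p,q}^{1/p}\Bigl(\sum_{i}q^iC_{g_1,g_2}^{\,q-i}\bigl(M_i(\mu)+M_i(\nu)\bigr)\Bigr)^{1/p}\begin{cases}n^{-1/(2p)}&\text{if }q>2p,\\ n^{-1/(2p)}(\log n)^{1/p}&\text{if }q=2p,\\ n^{-(q-p)/(pq)}&\text{if }p<q<2p,\end{cases}$$ where $i$ runs over all integers $0\le i<q$ and over $i=q$ (for integer $q$: $i=0,1,\dots,q$). -/

import Mathlib

open MeasureTheory ProbabilityTheory
open scoped NNReal ENNReal

namespace H2SW

/-- `ℝ^d` with the Euclidean norm. -/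
abbrev E (d : ℕ) : Type := EuclideanSpace ℝ (Fin d)

/-- The unit sphere `𝕊^{d-1}` of `ℝ^d`. -/
abbrev Sph (d : ℕ) : Type := Metric.sphere (0 : E d) 1

/-- The uniform distribution on the unit sphere of `ℝ^d`: normalized surface measure. -/
noncomputable def uniformSphere (d : ℕ) : Measure (Sph d) :=
  ((volume : Measure (E d)).toSphere Set.univ)⁻¹ • (volume : Measure (E d)).toSphere

/-- The couplings of two measures on the line. -/
def couplings (μ ν : Measure ℝ) : Set (Measure (ℝ × ℝ)) :=
  {π | π.map Prod.fst = μ ∧ π.map Prod.snd = ν}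

/-- `W_p^p(μ, ν; c)` for the one-dimensional ground metric `c`. -/
noncomputable def wassersteinPow (p : ℝ) (c : ℝ → ℝ → ℝ≥0) (μ ν : Measure ℝ) : ℝ≥0∞ :=
  ⨅ π ∈ couplings μ ν, ∫⁻ z, (c z.1 z.2 : ℝ≥0∞) ^ p ∂π

/-- The slicing map `x ↦ ψ₁ g₁(x₁, θ₁) + ψ₂ g₂(x₂, θ₂)` of the hierarchical hybrid Radon
transform. -/
noncomputable def slice {d₁ d₂ : ℕ} (g₁ : E d₁ → Sph d₁ → ℝ) (g₂ : E d₂ → Sph d₂ → ℝ)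
    (θ₁ : Sph d₁) (θ₂ : Sph d₂) (ψ : Sph 2) (x : E d₁ × E d₂) : ℝ :=
  (ψ : E 2) 0 * g₁ x.1 θ₁ + (ψ : E 2) 1 * g₂ x.2 θ₂

/-- The hierarchical hybrid sliced Wasserstein distance of order `p`, with directions
`(θ₁, θ₂, ψ)` uniform on `𝕊^{d₁-1} × 𝕊^{d₂-1} × 𝕊^1`. -/
noncomputable def h2sw {d₁ d₂ : ℕ} (p : ℝ) (c : ℝ → ℝ → ℝ≥0)
    (g₁ : E d₁ → Sph d₁ → ℝ) (g₂ : E d₂ → Sph d₂ → ℝ)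
    (μ ν : Measure (E d₁ × E d₂)) : ℝ≥0∞ :=
  (∫⁻ t, wassersteinPow p c (μ.map (slice g₁ g₂ t.1 t.2.1 t.2.2))
      (ν.map (slice g₁ g₂ t.1 t.2.1 t.2.2))
    ∂((uniformSphere d₁).prod ((uniformSphere d₂).prod (uniformSphere 2)))) ^ (1 / p)

/-- The ground metric `c(x, y) = |x - y|`. -/
def absMetric (x y : ℝ) : ℝ≥0 := Real.nnabs (x - y)

/-- The two families of defining functions: linear, and circular with radius `r`. -/
inductive Kind : Type
  | linear : Kind
  | circular (r : ℝ≥0) : Kind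

/-- The defining function on `ℝ^d × 𝕊^{d-1}` of a given kind: `⟨x, θ⟩` or `‖x - r θ‖`. -/
noncomputable def Kind.toFun (k : Kind) {d : ℕ} (x : E d) (θ : Sph d) : ℝ :=
  match k with
  | .linear => inner ℝ x (θ : E d)
  | .circular r => ‖x - (r : ℝ) • (θ : E d)‖

/-- The Euclidean norm of `x = (x₁, x₂)` in `ℝ^{d₁} × ℝ^{d₂}` (the norm of the product type is
the maximum norm). -/
noncomputable def jointNorm {d₁ d₂ : ℕ} (x : E d₁ × E d₂) : ℝ :=
  √(‖x.1‖ ^ 2 + ‖x.2‖ ^ 2)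

/-- The `k`-th moment is finite. -/
def FiniteMoment {d₁ d₂ : ℕ} (k : ℝ) (μ : Measure (E d₁ × E d₂)) : Prop :=
  Integrable (fun x => jointNorm x ^ k) μ

/-- The `k`-th moment `M_k(μ)`. -/
noncomputable def moment {d₁ d₂ : ℕ} (k : ℝ) (μ : Measure (E d₁ × E d₂)) : ℝ :=
  ∫ x, jointNorm x ^ k ∂μ

/-- `∑_i q^i C^{q-i} (M_i(μ) + M_i(ν))` over the integers `0 ≤ i < q` and `i = q`. For an integer
`q` this is the sum over `i = 0, …, q`. -/
noncomputable def momentSum {d₁ d₂ : ℕ} (q C : ℝ) (μ ν : Measure (E d₁ × E d₂)) : ℝ :=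
  ∑ i ∈ Finset.range ⌈q⌉₊, q ^ (i : ℝ) * C ^ (q - (i : ℝ)) * (moment (i : ℝ) μ + moment (i : ℝ) ν)
    + q ^ q * (moment q μ + moment q ν)

/-- The empirical distribution of the points `x 0, …, x (n-1)`. -/
noncomputable def empirical {α : Type*} [MeasurableSpace α] {n : ℕ} (x : Fin n → α) : Measure α :=
  (n : ℝ≥0∞)⁻¹ • ∑ i, Measure.dirac (x i)

/-- The rate of convergence, for `1 ≤ p < q`. -/
noncomputable def rate (p q : ℝ) (n : ℕ) : ℝ :=
  if 2 * p < q then (n : ℝ) ^ (-(1 / (2 * p)))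
  else if q = 2 * p then (n : ℝ) ^ (-(1 / (2 * p))) * Real.log n ^ (1 / p)
  else (n : ℝ) ^ (-((q - p) / (p * q)))

end H2SW

namespace H2SW

open Set

/-! The distance satisfies the triangle inequality, so the error is at most the sum of the
displacements of `μ_n` from `μ` and of `ν_n` from `ν`; by Jensen, each expected displacement is at
most the `1/p`-th power of the expected average over directions of one-dimensional `W_p^p`.

On the line, the quantile coupling gives `W_p^p ≤ 2^p p ∫ |x|^(p-1) |F_n(x) - F(x)| dx`
(`wassersteinPow_le_lintegral_cdf`). At each `x` the mean of `|F_n - F|` is at most `min(√(s/n),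
2s)`, where `s` bounds the tail beyond `|x|`; Markov gives `s = M/|x|^q`. Integrating, with the
square root used up to `n^(1/q)` and the linear bound beyond, produces the three rates
(`exists_le_rate_rpow`, `lintegral_tailBound_le`).

No dimension enters: every slice of `x` is bounded by `‖x₁‖ + ‖x₂‖ + r₁ + r₂`, so a single `M`,
built from the `q`-th moment and the radii, serves all directions. Only the terms `i = 0` and `i =
q` of the moment sum are needed (`le_momentSum`).

Measurability takes separate care, since an infimum over couplings is not visibly measurable:
Lipschitz dependence on directions and samples supplies it, or the explicit distribution-function
integral is used as a majorant. -/

/-! ### Powers of distances as weighted lengths -/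

lemma continuous_abs_rpow {s : ℝ} (hs : 0 ≤ s) : Continuous fun x : ℝ => |x| ^ s :=
  continuous_abs.rpow_const fun _ => Or.inr hs

/-- Superadditivity of `x ↦ x^p`: the right side equals `(s + c)^p - s^p`. -/
lemma rpow_le_integral_of_nonneg {p : ℝ} (hp : 1 ≤ p) {s c : ℝ} (hs : 0 ≤ s) (hc : 0 ≤ c) :
    c ^ p ≤ p * ∫ x in s..(s + c), |x| ^ (p - 1) := by
  have h1 : ∫ x in s..(s + c), |x| ^ (p - 1) = ∫ x in s..(s + c), x ^ (p - 1) := by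
    refine intervalIntegral.integral_congr fun x hx => ?_
    rw [uIcc_of_le (by linarith)] at hx
    simp only [abs_of_nonneg (hs.trans hx.1)]
  rw [h1, integral_rpow (Or.inl (by linarith)), sub_add_cancel, mul_div_cancel₀ _ (by linarith)]
  have := Real.add_rpow_le_rpow_add hs hc hp
  linarith

lemma rpow_sub_le_integral {p : ℝ} (hp : 1 ≤ p) {a b : ℝ} (hab : a ≤ b) :
    (b - a) ^ p ≤ 2 ^ p * p * ∫ x in a..b, |x| ^ (p - 1) := by
  have hi : ∀ u v : ℝ, IntervalIntegrable (fun x : ℝ => |x| ^ (p - 1)) volume u v := fun u v =>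
    (continuous_abs_rpow (by linarith)).intervalIntegrable u v
  have hnn : ∀ {u v : ℝ}, u ≤ v → 0 ≤ ∫ x in u..v, |x| ^ (p - 1) := fun h =>
    intervalIntegral.integral_nonneg h fun x _ => by positivity
  -- One of the two halves of `[a, b]` lies on a single side of `0`; keeping only that half costs
  -- the factor `2^p`.
  set m := (a + b) / 2 with hm
  have key : ((b - a) / 2) ^ p ≤ p * ∫ x in a..b, |x| ^ (p - 1) := by
    have hsplit := intervalIntegral.integral_add_adjacent_intervals (hi a m) (hi m b)
    have h1 := hnn (show a ≤ m by linarith)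
    have h2 := hnn (show m ≤ b by linarith)
    rcases le_total 0 m with h0 | h0
    · have := rpow_le_integral_of_nonneg hp h0 (show 0 ≤ (b - a) / 2 by linarith)
      rw [show m + (b - a) / 2 = b by rw [hm]; ring] at this
      refine this.trans ?_
      gcongr
      linarith
    · have := rpow_le_integral_of_nonneg hp (neg_nonneg.2 h0) (show 0 ≤ (b - a) / 2 by linarith)
      rw [show -m + (b - a) / 2 = -a by rw [hm]; ring] at this
      have hneg : ∫ x in -m..-a, |x| ^ (p - 1) = ∫ x in a..m, |x| ^ (p - 1) := by
        rw [← intervalIntegral.integral_comp_neg]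
        simp
      rw [hneg] at this
      refine this.trans ?_
      gcongr
      linarith
  calc (b - a) ^ p = 2 ^ p * ((b - a) / 2) ^ p := by
        rw [← Real.mul_rpow (by norm_num) (by linarith)]; congr 1; ring
    _ ≤ _ := by
        rw [mul_assoc]; gcongr

lemma ofReal_rpow_sub_le_lintegral {p : ℝ} (hp : 1 ≤ p) {a b : ℝ} (hab : a ≤ b) :
    ENNReal.ofReal ((b - a) ^ p) ≤
      ENNReal.ofReal (2 ^ p * p) * ∫⁻ x in Ico a b, ENNReal.ofReal (|x| ^ (p - 1)) := by
  have hi : IntegrableOn (fun x : ℝ => |x| ^ (p - 1)) (Ioc a b) volume :=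
    ((continuous_abs_rpow (by linarith)).intervalIntegrable a b).1
  rw [setLIntegral_congr (Ico_ae_eq_Ioc (a := a) (b := b)),
    ← ofReal_integral_eq_lintegral_ofReal hi (ae_of_all _ fun x => by positivity),
    ← ENNReal.ofReal_mul (by positivity), ← intervalIntegral.integral_of_le hab]
  exact ENNReal.ofReal_le_ofReal (rpow_sub_le_integral hp hab)

lemma ofReal_rpow_abs_sub_le_lintegral {p : ℝ} (hp : 1 ≤ p) (a b : ℝ) :
    ENNReal.ofReal (|a - b| ^ p) ≤ ENNReal.ofReal (2 ^ p * p) *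
      ∫⁻ x in Ico a b ∪ Ico b a, ENNReal.ofReal (|x| ^ (p - 1)) := by
  rcases le_total a b with h | h
  · rw [Ico_eq_empty_of_le h, union_empty, abs_sub_comm, abs_of_nonneg (sub_nonneg.2 h)]
    exact ofReal_rpow_sub_le_lintegral hp h
  · rw [Ico_eq_empty_of_le h, empty_union, abs_of_nonneg (sub_nonneg.2 h)]
    exact ofReal_rpow_sub_le_lintegral hp h

/-! ### Quantile coupling on the line -/

/-- The quantile function of a measure on the line, set to `0` outside the open unit interval. -/
noncomputable def quantile (α : Measure ℝ) (u : ℝ) : ℝ :=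
  open Classical in if u ∈ Ioo (0 : ℝ) 1 then sInf {x | u ≤ cdf α x} else 0

/-- The limits of the cdf at `±∞` make the infimum finite, and right continuity makes it attained.
-/
lemma quantile_le_iff (α : Measure ℝ) {u : ℝ} (hu : u ∈ Ioo (0 : ℝ) 1) (x : ℝ) :
    quantile α u ≤ x ↔ u ≤ cdf α x := by
  rw [quantile, if_pos hu]
  have hbdd : BddBelow {x | u ≤ cdf α x} := by
    obtain ⟨y, hy⟩ := ((tendsto_cdf_atBot α).eventually_lt_const hu.1).exists
    refine ⟨y, fun z hz => ?_⟩
    by_contra! h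
    exact absurd (hz.trans (monotone_cdf α h.le)) (not_le.2 hy)
  have hne : {x | u ≤ cdf α x}.Nonempty := by
    obtain ⟨y, hy⟩ := ((tendsto_cdf_atTop α).eventually_const_lt hu.2).exists
    exact ⟨y, hy.le⟩
  refine ⟨fun h => ?_, fun h => csInf_le hbdd h⟩
  have hr : Filter.Tendsto (cdf α) (nhdsWithin x (Ioi x)) (nhds (cdf α x)) :=
    ((cdf α).right_continuous x).mono Ioi_subset_Ici_self
  refine ge_of_tendsto hr (eventually_nhdsWithin_of_forall fun y hy => ?_)
  obtain ⟨z, hz, hzy⟩ := exists_lt_of_csInf_lt hne (lt_of_le_of_lt h hy)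
  exact hz.trans (monotone_cdf α hzy.le)

lemma measurable_quantile (α : Measure ℝ) : Measurable (quantile α) := by
  refine measurable_of_Iic fun x => ?_
  have : quantile α ⁻¹' Iic x =
      (Ioo 0 1 ∩ Iic (cdf α x)) ∪ ((Ioo (0 : ℝ) 1)ᶜ ∩ {_u | 0 ≤ x}) := by
    ext u
    by_cases hu : u ∈ Ioo (0 : ℝ) 1
    · simp only [mem_preimage, mem_Iic, quantile_le_iff α hu, mem_union, mem_inter_iff, hu,
        mem_compl_iff, true_and, not_true_eq_false, false_and, or_false]
    · simp only [mem_preimage, mem_Iic, mem_union, mem_inter_iff, hu, mem_compl_iff, false_and,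
        not_false_eq_true, true_and, false_or, mem_ofPred_eq]
      rw [quantile, if_neg hu]
  rw [this]
  exact (measurableSet_Ioo.inter measurableSet_Iic).union
    (measurableSet_Ioo.compl.inter (MeasurableSet.const _))

lemma map_quantile (α : Measure ℝ) [IsProbabilityMeasure α] :
    (volume.restrict (Ioo (0 : ℝ) 1)).map (quantile α) = α := by
  have : IsFiniteMeasure (volume.restrict (Ioo (0 : ℝ) 1)) := ⟨by simp⟩
  refine Measure.ext_of_Iic _ _ fun x => ?_
  rw [Measure.map_apply (measurable_quantile α) measurableSet_Iic,
    Measure.restrict_apply (measurable_quantile α measurableSet_Iic)]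
  have : quantile α ⁻¹' Iic x ∩ Ioo 0 1 = Ioo 0 1 ∩ Iic (cdf α x) := by
    ext u
    simp only [mem_inter_iff, mem_preimage, mem_Iic]
    constructor
    · rintro ⟨h, hu⟩; exact ⟨hu, (quantile_le_iff α hu x).1 h⟩
    · rintro ⟨hu, h⟩; exact ⟨(quantile_le_iff α hu x).2 h, hu⟩
  rw [this, ← ofReal_cdf]
  have hae : (Ioo (0 : ℝ) 1 ∩ Iic (cdf α x) : Set ℝ) =ᵐ[volume]
      (Ioc 0 1 ∩ Iic (cdf α x) : Set ℝ) :=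
    Ioo_ae_eq_Ioc.inter (ae_eq_refl _)
  rw [measure_congr hae, Ioc_inter_Iic, inf_eq_right.2 (cdf_le_one α x), Real.volume_Ioc, sub_zero]

/-- By `quantile_le_iff`, `x` separates the two quantiles at level `u` exactly when `u` separates
the two cdf values at `x`. -/
lemma volume_quantile_separated (α β : Measure ℝ) (x : ℝ) :
    (volume.restrict (Ioo (0 : ℝ) 1))
      {u | x ∈ Ico (quantile α u) (quantile β u) ∪ Ico (quantile β u) (quantile α u)} ≤
      ENNReal.ofReal |cdf α x - cdf β x| := by
  rw [Measure.restrict_apply' measurableSet_Ioo]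
  refine (measure_mono (t := uIoc (cdf α x) (cdf β x)) ?_).trans ?_
  · rintro u ⟨hu, hu1⟩
    simp only [mem_ofPred_eq, mem_union, mem_Ico, ← not_le, quantile_le_iff _ hu1] at hu
    rw [mem_uIoc]
    rcases hu with ⟨h1, h2⟩ | ⟨h1, h2⟩
    · exact Or.inr ⟨not_le.1 h2, h1⟩
    · exact Or.inl ⟨not_le.1 h2, h1⟩
  · rw [uIoc, Real.volume_Ioc, max_sub_min_eq_abs, abs_sub_comm]

lemma quantile_mem_couplings (α β : Measure ℝ) [IsProbabilityMeasure α] [IsProbabilityMeasure β] :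
    (volume.restrict (Ioo (0 : ℝ) 1)).map (fun u => (quantile α u, quantile β u)) ∈
      couplings α β := by
  have hα := measurable_quantile α
  have hβ := measurable_quantile β
  constructor
  · rw [Measure.map_map measurable_fst (hα.prodMk hβ)]
    exact map_quantile α
  · rw [Measure.map_map measurable_snd (hα.prodMk hβ)]
    exact map_quantile β

lemma absMetric_rpow (p : ℝ) (hp : 0 ≤ p) (x y : ℝ) :
    (absMetric x y : ℝ≥0∞) ^ p = ENNReal.ofReal (|x - y| ^ p) := by
  rw [← ENNReal.ofReal_rpow_of_nonneg (abs_nonneg _) hp]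
  congr 1
  rw [absMetric, ← ENNReal.ofReal_coe_nnreal, Real.coe_nnabs]

lemma measurable_ofReal_abs_sub_rpow (p : ℝ) :
    Measurable fun z : ℝ × ℝ => ENNReal.ofReal (|z.1 - z.2| ^ p) :=
  ENNReal.measurable_ofReal.comp
    ((measurable_norm.comp (measurable_fst.sub measurable_snd)).pow_const p)

/-- The `p`-th power of the Wasserstein distance on the line is bounded by a weighted
`L¹` distance of the distribution functions. -/
lemma wassersteinPow_le_lintegral_cdf {p : ℝ} (hp : 1 ≤ p) (α β : Measure ℝ)
    [IsProbabilityMeasure α] [IsProbabilityMeasure β] :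
    wassersteinPow p absMetric α β ≤ ENNReal.ofReal (2 ^ p * p) *
      ∫⁻ x, ENNReal.ofReal (|x| ^ (p - 1)) * ENNReal.ofReal |cdf α x - cdf β x| := by
  have hα := measurable_quantile α
  have hβ := measurable_quantile β
  refine (iInf₂_le _ (quantile_mem_couplings α β)).trans ?_
  simp only [absMetric_rpow p (by linarith)]
  rw [lintegral_map (measurable_ofReal_abs_sub_rpow p) (hα.prodMk hβ)]
  set S : ℝ → Set ℝ := fun u =>
    Ico (quantile α u) (quantile β u) ∪ Ico (quantile β u) (quantile α u) with hS
  have hSm : ∀ u, MeasurableSet (S u) := fun u => measurableSet_Ico.union measurableSet_Ico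
  have hjoint : MeasurableSet {z : ℝ × ℝ | z.2 ∈ S z.1} := by
    refine (MeasurableSet.inter ?_ ?_).union (MeasurableSet.inter ?_ ?_)
    · exact measurableSet_le (hα.comp measurable_fst) measurable_snd
    · exact measurableSet_lt measurable_snd (hβ.comp measurable_fst)
    · exact measurableSet_le (hβ.comp measurable_fst) measurable_snd
    · exact measurableSet_lt measurable_snd (hα.comp measurable_fst)
  set w : ℝ → ℝ≥0∞ := fun x => ENNReal.ofReal (|x| ^ (p - 1)) with hw
  have hwm : Measurable w := ENNReal.measurable_ofReal.comp (measurable_norm.pow_const _)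
  calc ∫⁻ u in Ioo (0 : ℝ) 1, ENNReal.ofReal (|quantile α u - quantile β u| ^ p)
      ≤ ∫⁻ u in Ioo (0 : ℝ) 1, ENNReal.ofReal (2 ^ p * p) * ∫⁻ x, (S u).indicator w x := by
        refine lintegral_mono fun u => ?_
        rw [lintegral_indicator (hSm u)]
        exact ofReal_rpow_abs_sub_le_lintegral hp _ _
    _ = ENNReal.ofReal (2 ^ p * p) * ∫⁻ u in Ioo (0 : ℝ) 1, ∫⁻ x, (S u).indicator w x :=
        lintegral_const_mul' _ _ ENNReal.ofReal_ne_top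
    -- Tonelli on the region between the quantile graphs: its sections at fixed `u` are intervals
    -- between quantiles, those at fixed `x` lie between cdf values.
    _ = ENNReal.ofReal (2 ^ p * p) * ∫⁻ x, ∫⁻ u in Ioo (0 : ℝ) 1, (S u).indicator w x := by
        rw [lintegral_lintegral_swap]
        have : Function.uncurry (fun u x => (S u).indicator w x) =
            {z : ℝ × ℝ | z.2 ∈ S z.1}.indicator fun z => w z.2 := rfl
        rw [this]
        exact ((hwm.comp measurable_snd).indicator hjoint).aemeasurable
    _ ≤ _ := by
        gcongr with x
        have : ∀ u, (S u).indicator w x = {u | x ∈ S u}.indicator (fun _ => w x) u :=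
          fun u => rfl
        simp only [this]
        have hx : MeasurableSet {u | x ∈ S u} := measurable_prodMk_right hjoint
        rw [lintegral_indicator_const hx]
        gcongr
        exact volume_quantile_separated α β x

/-! ### Mean deviation of empirical frequencies -/

section Empirical

variable {α : Type*} [MeasurableSpace α] {n : ℕ}

lemma isProbabilityMeasure_empirical (hn : 1 ≤ n) (x : Fin n → α) :
    IsProbabilityMeasure (empirical x) := by
  constructor
  have : (n : ℝ≥0∞) ≠ 0 := by exact_mod_cast (by omega : n ≠ 0)
  simp [empirical, ENNReal.inv_mul_cancel this]

lemma lintegral_empirical (x : Fin n → α) {f : α → ℝ≥0∞} (hf : Measurable f) :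
    ∫⁻ a, f a ∂(empirical x) = (n : ℝ≥0∞)⁻¹ * ∑ i, f (x i) := by
  rw [empirical, lintegral_smul_measure, lintegral_finsetSum_measure, smul_eq_mul]
  simp only [lintegral_dirac' _ hf]

lemma map_empirical {β : Type*} [MeasurableSpace β] (x : Fin n → α) {f : α → β}
    (hf : Measurable f) : (empirical x).map f = empirical fun i => f (x i) := by
  rw [empirical, Measure.map_smul, Measure.map_finset_sum hf.aemeasurable]
  simp only [Measure.map_dirac' hf, empirical]

lemma empirical_real_apply (x : Fin n → α) {A : Set α} (hA : MeasurableSet A) :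
    (empirical x).real A = (n : ℝ)⁻¹ * ∑ i, A.indicator (fun _ => (1 : ℝ)) (x i) := by
  have h : ∀ i, (A.indicator (1 : α → ℝ≥0∞) (x i)).toReal =
      A.indicator (fun _ => (1 : ℝ)) (x i) := fun i => by
    by_cases hi : x i ∈ A <;> simp [hi]
  rw [Measure.real, empirical, Measure.smul_apply, Measure.finsetSum_apply, smul_eq_mul,
    ENNReal.toReal_mul, ENNReal.toReal_sum]
  · simp only [Measure.dirac_apply' _ hA, h, ENNReal.toReal_inv, ENNReal.toReal_natCast]
  · intro i _; exact measure_ne_top _ _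

lemma integral_abs_sq_le {μ : Measure α} [IsProbabilityMeasure μ] {f : α → ℝ} (hf : MemLp f 2 μ) :
    (∫ a, |f a| ∂μ) ^ 2 ≤ ∫ a, f a ^ 2 ∂μ := by
  have h := variance_eq_sub hf.norm
  have h0 := variance_nonneg (fun a => ‖f a‖) μ
  rw [h] at h0
  simp only [Pi.pow_apply, Real.norm_eq_abs, sq_abs] at h0
  linarith

/-- The square root comes from the variance of a sum of independent indicators, the linear bound
from the triangle inequality. The latter wins for sets of mass below order `1/n`, which is what
controls the far tail. -/
lemma integral_abs_empirical_sub_le (hn : 1 ≤ n) (μ : Measure α) [IsProbabilityMeasure μ]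
    {A : Set α} (hA : MeasurableSet A) :
    ∫ x, |(empirical x).real A - μ.real A| ∂(Measure.pi fun _ : Fin n => μ) ≤
      min √(μ.real A / n) (2 * μ.real A) := by
  set π := Measure.pi fun _ : Fin n => μ
  set f : α → ℝ := A.indicator (fun _ => (1 : ℝ)) with hf
  have hn0 : (0 : ℝ) < n := by exact_mod_cast hn
  have hfm : Measurable f := measurable_const.indicator hA
  have hfL : MemLp f 2 μ := memLp_indicator_const 2 hA 1 (Or.inr (measure_ne_top _ _))
  have hpres : ∀ i : Fin n, MeasurePreserving (fun x : Fin n → α => x i) π μ := fun i =>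
    measurePreserving_eval _ i
  have hfi : ∀ i : Fin n, MemLp (fun x : Fin n → α => f (x i)) 2 π := fun i =>
    hfL.comp_measurePreserving (hpres i)
  have hintf : ∫ a, f a ∂μ = μ.real A := by rw [hf, integral_indicator_const _ hA]; simp
  have hinti : ∀ i : Fin n, ∫ x, f (x i) ∂π = μ.real A := fun i => by
    rw [← hintf, ← (hpres i).map_eq, integral_map (hpres i).aemeasurable hfm.aestronglyMeasurable]
  have hYL : MemLp (∑ i : Fin n, fun x : Fin n → α => f (x i)) 2 π :=
    memLp_finsetSum' _ fun i _ => hfi i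
  have hemp : ∀ x : Fin n → α, (empirical x).real A =
      (n : ℝ)⁻¹ * (∑ i : Fin n, fun x : Fin n → α => f (x i)) x := fun x => by
    rw [empirical_real_apply x hA, Finset.sum_apply]
  have hEY : ∫ x, (∑ i : Fin n, fun x : Fin n → α => f (x i)) x ∂π = n * μ.real A := by
    simp only [Finset.sum_apply]
    rw [integral_finsetSum _ fun i _ => (hfi i).integrable (by norm_num)]
    simp [hinti]
  have hvar : Var[∑ i : Fin n, fun x : Fin n → α => f (x i); π] ≤ n * μ.real A := by
    rw [variance_sum_pi (X := fun _ => f) fun _ => hfL]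
    have : Var[f; μ] ≤ μ.real A := by
      refine (variance_le_expectation_sq hfm.aestronglyMeasurable).trans (le_of_eq ?_)
      rw [← hintf]
      congr 1; ext a
      by_cases ha : a ∈ A <;> simp [hf, ha]
    simpa using mul_le_mul_of_nonneg_left this hn0.le
  have hgL : MemLp (fun x : Fin n → α => (empirical x).real A - μ.real A) 2 π := by
    simp only [hemp]
    exact (hYL.const_mul _).sub (memLp_const _)
  have hempint : Integrable (fun x : Fin n → α => (empirical x).real A) π := by
    simp only [hemp]
    exact (hYL.integrable (by norm_num)).const_mul _
  refine le_min ?_ ?_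
  · refine Real.le_sqrt_of_sq_le ((integral_abs_sq_le hgL).trans ?_)
    have : ∀ x : Fin n → α, ((empirical x).real A - μ.real A) ^ 2 = (n : ℝ)⁻¹ ^ 2 *
        ((∑ i : Fin n, fun x : Fin n → α => f (x i)) x -
          ∫ x, (∑ i : Fin n, fun x : Fin n → α => f (x i)) x ∂π) ^ 2 := fun x => by
      rw [hemp, hEY, ← mul_pow, mul_sub, inv_mul_cancel_left₀ hn0.ne']
    simp only [this]
    rw [integral_const_mul, ← variance_eq_integral hYL.aestronglyMeasurable.aemeasurable]
    calc _ ≤ (n : ℝ)⁻¹ ^ 2 * (n * μ.real A) := by gcongr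
      _ = μ.real A / n := by field_simp
  · have h1 : ∫ x, (empirical x).real A ∂π = μ.real A := by
      simp only [hemp]
      rw [integral_const_mul, hEY, inv_mul_cancel_left₀ hn0.ne']
    calc _ ≤ ∫ x, ((empirical x).real A + μ.real A) ∂π := by
          refine integral_mono (hgL.integrable (by norm_num)).abs
            (hempint.add (integrable_const _)) fun x => ?_
          have : 0 ≤ (empirical x).real A := measureReal_nonneg
          have : 0 ≤ μ.real A := measureReal_nonneg
          simp only [abs_le]; constructor <;> linarith
      _ = 2 * μ.real A := by
          rw [integral_add hempint (integrable_const _), h1]; simp; ring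

lemma measurable_empirical_real {A : Set α} (hA : MeasurableSet A) :
    Measurable fun x : Fin n → α => (empirical x).real A := by
  simp only [empirical_real_apply _ hA]
  exact (Finset.measurable_sum _ fun i _ =>
    (measurable_const.indicator hA).comp (measurable_pi_apply i)).const_mul _

/-- A set and its complement have the same deviation, so it suffices that either one is small; this
treats both tails of a cdf alike. -/
lemma lintegral_abs_empirical_sub_le (hn : 1 ≤ n) (μ : Measure α) [IsProbabilityMeasure μ]
    {A : Set α} (hA : MeasurableSet A) {s : ℝ} (hs : μ.real A ≤ s ∨ μ.real Aᶜ ≤ s) :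
    ∫⁻ x, ENNReal.ofReal |(empirical x).real A - μ.real A| ∂(Measure.pi fun _ : Fin n => μ) ≤
      ENNReal.ofReal (min √(s / n) (2 * s)) := by
  have key : ∀ {B : Set α}, MeasurableSet B → μ.real B ≤ s →
      ∫⁻ x, ENNReal.ofReal |(empirical x).real B - μ.real B| ∂(Measure.pi fun _ : Fin n => μ) ≤
      ENNReal.ofReal (min √(s / n) (2 * s)) := by
    intro B hB hBs
    have hm := (measurable_empirical_real (n := n) hB).sub_const (μ.real B)
    rw [← ofReal_integral_eq_lintegral_ofReal]
    · refine ENNReal.ofReal_le_ofReal ((integral_abs_empirical_sub_le hn μ hB).trans ?_)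
      gcongr
    · refine Integrable.abs (Integrable.of_bound hm.aestronglyMeasurable 1 (ae_of_all _ fun x => ?_))
      have := isProbabilityMeasure_empirical hn x
      have h1 : (empirical x).real B ≤ 1 := measureReal_le_one
      have h2 : 0 ≤ (empirical x).real B := measureReal_nonneg
      have h3 : μ.real B ≤ 1 := measureReal_le_one
      have h4 : 0 ≤ μ.real B := measureReal_nonneg
      rw [Real.norm_eq_abs, abs_le]; constructor <;> linarith
    · exact ae_of_all _ fun x => abs_nonneg _
  rcases hs with hs | hs
  · exact key hA hs
  · refine le_trans (le_of_eq ?_) (key hA.compl hs)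
    congr 1; ext x
    have := isProbabilityMeasure_empirical hn x
    rw [probReal_compl_eq_one_sub hA, probReal_compl_eq_one_sub hA, sub_sub_sub_cancel_left,
      abs_sub_comm]

end Empirical

/-! ### The rate and its three regimes -/

lemma rate_nonneg (p q : ℝ) (n : ℕ) : 0 ≤ rate p q n := by
  unfold rate
  have := Real.log_natCast_nonneg n
  split_ifs <;> positivity

lemma rate_rpow_of_lt {p q : ℝ} (hp : 1 ≤ p) (h : 2 * p < q) (n : ℕ) :
    rate p q n ^ p = (n : ℝ) ^ (-(1 / 2) : ℝ) := by
  rw [rate, if_pos h, ← Real.rpow_mul (Nat.cast_nonneg n)]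
  congr 1; field_simp

lemma rate_rpow_of_eq {p q : ℝ} (hp : 1 ≤ p) (h : q = 2 * p) (n : ℕ) :
    rate p q n ^ p = (n : ℝ) ^ (-(1 / 2) : ℝ) * Real.log n := by
  have := Real.log_natCast_nonneg n
  rw [rate, if_neg (by linarith), if_pos h, Real.mul_rpow (by positivity) (by positivity),
    ← Real.rpow_mul (Nat.cast_nonneg n), ← Real.rpow_mul this, one_div_mul_cancel (by linarith),
    Real.rpow_one]
  congr 2; field_simp

lemma rate_rpow_of_gt {p q : ℝ} (hp : 1 ≤ p) (hpq : p < q) (h : q < 2 * p) (n : ℕ) :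
    rate p q n ^ p = (n : ℝ) ^ (-((q - p) / q)) := by
  rw [rate, if_neg (by linarith), if_neg (by linarith), ← Real.rpow_mul (Nat.cast_nonneg n)]
  have : q ≠ 0 := by linarith
  congr 1; field_simp

lemma integral_one_rpow_le {s T : ℝ} (hT : 1 ≤ T) (hs : s ≠ 0) :
    ∫ x in (1 : ℝ)..T, x ^ (s - 1) = (T ^ s - 1) / s := by
  rw [integral_rpow (Or.inr ⟨by intro h; apply hs; linarith, ?_⟩)]
  · simp
  · rw [uIcc_of_le hT]
    exact fun h => by linarith [h.1]

/-- The three quantities that the truncation at level `n ^ (1 / q)` produces are all bounded by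
the `p`-th power of the rate. -/
lemma exists_le_rate_rpow {p q : ℝ} (hp : 1 ≤ p) (hpq : p < q) :
    ∃ D : ℝ, 0 ≤ D ∧ ∀ n : ℕ, 1 ≤ n → (q = 2 * p → 2 ≤ n) →
      (n : ℝ) ^ (-(1 / 2) : ℝ) ≤ D * rate p q n ^ p ∧
      (n : ℝ) ^ (-(1 / 2) : ℝ) * (∫ x in (1 : ℝ)..((n : ℝ) ^ (1 / q)), x ^ (p - q / 2 - 1)) ≤
        D * rate p q n ^ p ∧
      ((n : ℝ) ^ (1 / q)) ^ (p - q) ≤ D * rate p q n ^ p := by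
  have hq : 0 < q := by linarith
  have hT : ∀ n : ℕ, 1 ≤ n → (1 : ℝ) ≤ (n : ℝ) ^ (1 / q) := fun n hn =>
    Real.one_le_rpow (by exact_mod_cast hn) (by positivity)
  have hTpq : ∀ n : ℕ, ((n : ℝ) ^ (1 / q)) ^ (p - q) = (n : ℝ) ^ (-((q - p) / q)) := fun n => by
    rw [← Real.rpow_mul (Nat.cast_nonneg n)]; congr 1; ring
  rcases lt_trichotomy q (2 * p) with h | h | h
  · have hs : 0 < p - q / 2 := by linarith
    -- The exponent `p - q/2` is positive, so the upper limit dominates the integral: `n^(-1/2)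
    -- (n^(1/q))^(p - q/2) = n^(-(q-p)/q)`.
    refine ⟨1 + 1 / (p - q / 2), by positivity, fun n hn _ => ?_⟩
    have hn1 : (1 : ℝ) ≤ n := by exact_mod_cast hn
    have hn0 : (0 : ℝ) < n := by linarith
    rw [rate_rpow_of_gt hp hpq h, hTpq]
    set r := (n : ℝ) ^ (-((q - p) / q)) with hr
    have hr0 : 0 ≤ r := by positivity
    have hd : 0 ≤ 1 / (p - q / 2) * r := by positivity
    refine ⟨?_, ?_, by linarith⟩
    · have : (n : ℝ) ^ (-(1 / 2) : ℝ) ≤ r := by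
        refine Real.rpow_le_rpow_of_exponent_le hn1 ?_
        rw [neg_le_neg_iff, div_le_div_iff₀ hq (by norm_num)]; linarith
      linarith
    · rw [integral_one_rpow_le (hT n hn) hs.ne']
      have e : (n : ℝ) ^ (-(1 / 2) : ℝ) * ((n : ℝ) ^ (1 / q)) ^ (p - q / 2) = r := by
        rw [← Real.rpow_mul hn0.le, ← Real.rpow_add hn0, hr]
        congr 1; field_simp; ring
      have hm : 0 ≤ (n : ℝ) ^ (-(1 / 2) : ℝ) * (1 / (p - q / 2)) := by positivity
      have : (n : ℝ) ^ (-(1 / 2) : ℝ) * ((((n : ℝ) ^ (1 / q)) ^ (p - q / 2) - 1) / (p - q / 2)) =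
          1 / (p - q / 2) * r - (n : ℝ) ^ (-(1 / 2) : ℝ) * (1 / (p - q / 2)) := by
        rw [← e]; ring
      rw [this]; linarith
  · have hl2 := Real.log_pos (show (1 : ℝ) < 2 by norm_num)
    -- The integral is `log n / q`. The term `1 / log 2` absorbs the summands without a logarithm
    -- and needs `n ≥ 2`, since the rate vanishes at `n = 1`.
    refine ⟨1 / Real.log 2 + 1 / q, by positivity, fun n hn hn2 => ?_⟩
    have hn2' : (2 : ℝ) ≤ n := by exact_mod_cast hn2 h
    have hn0 : (0 : ℝ) < n := by linarith
    have hlog : Real.log 2 ≤ Real.log n := Real.log_le_log (by norm_num) hn2'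
    have hlog0 : 0 < Real.log n := hl2.trans_le hlog
    rw [rate_rpow_of_eq hp h, hTpq]
    set r := (n : ℝ) ^ (-(1 / 2) : ℝ) with hr
    have hr0 : 0 ≤ r := by positivity
    have hA : r ≤ 1 / Real.log 2 * (r * Real.log n) := by
      have : 1 ≤ 1 / Real.log 2 * Real.log n := by
        rw [one_div_mul_eq_div, one_le_div hl2]; exact hlog
      nlinarith
    have hB : 0 ≤ 1 / q * (r * Real.log n) := by positivity
    have hA0 : 0 ≤ 1 / Real.log 2 * (r * Real.log n) := by positivity
    refine ⟨by linarith, ?_, ?_⟩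
    · have e : ∫ x in (1 : ℝ)..((n : ℝ) ^ (1 / q)), x ^ (p - q / 2 - 1) = 1 / q * Real.log n := by
        have : p - q / 2 - 1 = -1 := by rw [h]; ring
        simp only [this, Real.rpow_neg_one]
        rw [integral_inv_of_pos one_pos (by positivity), div_one, Real.log_rpow hn0]
      rw [e]; linarith
    · have : (n : ℝ) ^ (-((q - p) / q)) = r := by
        rw [hr]; congr 1; rw [h]; field_simp; ring
      rw [this]; linarith
  · have hs : 0 < q / 2 - p := by linarith
    -- Here the integral stays bounded by its value `1 / (q/2 - p)` over the whole half-line.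
    refine ⟨1 + 1 / (q / 2 - p), by positivity, fun n hn _ => ?_⟩
    have hn1 : (1 : ℝ) ≤ n := by exact_mod_cast hn
    rw [rate_rpow_of_lt hp h, hTpq]
    set r := (n : ℝ) ^ (-(1 / 2) : ℝ) with hr
    have hr0 : 0 ≤ r := by positivity
    have hd : 0 ≤ 1 / (q / 2 - p) * r := by positivity
    refine ⟨by linarith, ?_, ?_⟩
    · rw [integral_one_rpow_le (hT n hn) (by linarith)]
      have h1 : 0 ≤ ((n : ℝ) ^ (1 / q)) ^ (p - q / 2) := by positivity
      have : (((n : ℝ) ^ (1 / q)) ^ (p - q / 2) - 1) / (p - q / 2) ≤ 1 / (q / 2 - p) := by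
        rw [show p - q / 2 = -(q / 2 - p) by ring, div_neg, ← neg_div]
        gcongr
        rw [show p - q / 2 = -(q / 2 - p) by ring] at h1
        linarith
      have := mul_le_mul_of_nonneg_left this hr0
      linarith
    · have : (n : ℝ) ^ (-((q - p) / q)) ≤ r := by
        refine Real.rpow_le_rpow_of_exponent_le hn1 ?_
        rw [neg_le_neg_iff, div_le_div_iff₀ (by norm_num) hq]; linarith
      linarith

/-! ### Integrating the tail bound -/

/-- An upper bound for the tail `P(|Z| ≥ |x|)` of a real random variable with `q`-th moment `M`. -/
noncomputable def tailBound (q M x : ℝ) : ℝ :=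
  if |x| ≤ 1 then 1 else M / |x| ^ q

lemma lintegral_comp_abs (g : ℝ → ℝ≥0∞) :
    ∫⁻ x, g |x| = 2 * ∫⁻ x in Ioi 0, g x := by
  have h1 : ∫⁻ x in Iic 0, g |x| = ∫⁻ x in Ioi 0, g |x| := by
    have := (Measure.measurePreserving_neg (volume : Measure ℝ)).setLIntegral_comp_preimage_emb
      (MeasurableEquiv.neg ℝ).measurableEmbedding (fun x => g |x|) (Ici 0)
    rw [← setLIntegral_congr (Ioi_ae_eq_Ici (a := (0 : ℝ))).symm, ← this]
    simp
  have h2 : ∫⁻ x in Ioi 0, g |x| = ∫⁻ x in Ioi 0, g x :=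
    setLIntegral_congr_fun measurableSet_Ioi fun x hx => by
      simp only [abs_of_pos (mem_Ioi.1 hx)]
  rw [← lintegral_add_compl _ (measurableSet_Iic (a := (0 : ℝ))), compl_Iic, h1, h2, two_mul]

/-- By evenness only `x > 0` counts, with a factor 2. On `(0, 1]` the tail is bounded by 1, on `(1,
T]` the square root is used, beyond `T` the linear bound, integrable because `q > p`. The choice `T
= n^(1/q)`, made later, balances `√(x^(-q)/n)` against `x^(-q)`. -/
lemma lintegral_tailBound_le {p q : ℝ} (hp : 1 ≤ p) (hpq : p < q) {M T : ℝ} (hM : 0 ≤ M)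
    (hT : 1 ≤ T) {n : ℕ} (hn : 1 ≤ n) :
    ∫⁻ x, ENNReal.ofReal (|x| ^ (p - 1)) *
      ENNReal.ofReal (min √(tailBound q M x / n) (2 * tailBound q M x)) ≤
    ENNReal.ofReal (2 * ((n : ℝ) ^ (-(1 / 2) : ℝ) +
      √M * ((n : ℝ) ^ (-(1 / 2) : ℝ) * ∫ x in (1 : ℝ)..T, x ^ (p - q / 2 - 1)) +
      2 * M * (T ^ (p - q) / (q - p)))) := by
  have hn0 : (0 : ℝ) < n := by exact_mod_cast hn
  have hsqrt : (n : ℝ) ^ (-(1 / 2) : ℝ) = 1 / √n := by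
    rw [Real.rpow_neg hn0.le, ← Real.sqrt_eq_rpow, one_div]
  set r := (n : ℝ) ^ (-(1 / 2) : ℝ) with hr
  have hr0 : 0 ≤ r := by positivity
  set g : ℝ → ℝ≥0∞ := fun x => ENNReal.ofReal (x ^ (p - 1)) *
      ENNReal.ofReal (min √(tailBound q M x / n) (2 * tailBound q M x)) with hg
  have habs : ∀ x, ENNReal.ofReal (|x| ^ (p - 1)) *
      ENNReal.ofReal (min √(tailBound q M x / n) (2 * tailBound q M x)) = g |x| := fun x => by
    simp only [hg, tailBound, abs_abs]
  simp only [habs]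
  rw [lintegral_comp_abs, ENNReal.ofReal_mul (by norm_num), ENNReal.ofReal_ofNat]
  have hint : 0 ≤ ∫ x in (1 : ℝ)..T, x ^ (p - q / 2 - 1) :=
    intervalIntegral.integral_nonneg hT fun x hx => Real.rpow_nonneg (by linarith [hx.1]) _
  have hqp : 0 < q - p := by linarith
  rw [ENNReal.ofReal_add (by positivity) (by positivity), ENNReal.ofReal_add hr0 (by positivity)]
  have h1 : ∫⁻ x in Ioc 0 1, g x ≤ ENNReal.ofReal r := by
    calc _ ≤ ∫⁻ x in Ioc (0 : ℝ) 1, ENNReal.ofReal r := by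
          refine setLIntegral_mono measurable_const fun x hx => ?_
          have hx1 : |x| ≤ 1 := by rw [abs_of_pos hx.1]; exact hx.2
          rw [hg]
          simp only [tailBound, if_pos hx1]
          rw [← ENNReal.ofReal_mul (Real.rpow_nonneg hx.1.le _)]
          refine ENNReal.ofReal_le_ofReal ?_
          calc x ^ (p - 1) * min √(1 / n) (2 * 1) ≤ 1 * √(1 / n) := by
                gcongr
                · exact Real.rpow_le_one hx.1.le hx.2 (by linarith)
                · exact min_le_left _ _
            _ = r := by rw [one_mul, hsqrt]; simp
      _ = _ := by simp
  have h2 : ∫⁻ x in Ioc 1 T, g x ≤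
      ENNReal.ofReal (√M * (r * ∫ x in (1 : ℝ)..T, x ^ (p - q / 2 - 1))) := by
    have hc : ContinuousOn (fun x : ℝ => √M * r * x ^ (p - q / 2 - 1)) (uIcc 1 T) := by
      rw [uIcc_of_le hT]
      refine continuousOn_const.mul (continuousOn_id.rpow_const fun x hx => Or.inl ?_)
      exact (zero_lt_one.trans_le hx.1).ne'
    rw [← mul_assoc, ← intervalIntegral.integral_const_mul, intervalIntegral.integral_of_le hT,
      ofReal_integral_eq_lintegral_ofReal hc.intervalIntegrable.1]
    · refine setLIntegral_mono' measurableSet_Ioc fun x hx => ?_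
      have hx0 : 0 < x := zero_lt_one.trans hx.1
      have hx1 : ¬ x ≤ 1 := not_le.2 hx.1
      rw [hg]
      simp only [tailBound, abs_of_pos hx0, if_neg hx1]
      rw [← ENNReal.ofReal_mul (Real.rpow_nonneg hx0.le _)]
      refine ENNReal.ofReal_le_ofReal ?_
      calc _ ≤ x ^ (p - 1) * √(M / x ^ q / n) := by
            gcongr
            exact min_le_left _ _
        _ = √M * r * (x ^ (p - 1) / x ^ (q / 2)) := by
            rw [Real.sqrt_div (by positivity), Real.sqrt_div hM, hsqrt,
              Real.sqrt_eq_rpow (x ^ q), ← Real.rpow_mul hx0.le, mul_one_div q 2]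
            ring
        _ = √M * r * x ^ (p - q / 2 - 1) := by
            rw [← Real.rpow_sub hx0]; ring_nf
    · refine (ae_restrict_iff' measurableSet_Ioc).2 (ae_of_all _ fun x hx => ?_)
      have hx0 : 0 < x := zero_lt_one.trans hx.1
      simp only [Pi.zero_apply]; positivity
  have h3 : ∫⁻ x in Ioi T, g x ≤ ENNReal.ofReal (2 * M * (T ^ (p - q) / (q - p))) := by
    have hT0 : 0 < T := by linarith
    have hi : IntegrableOn (fun x : ℝ => 2 * M * x ^ (p - 1 - q)) (Ioi T) :=
      (integrableOn_Ioi_rpow_of_lt (by linarith) hT0).const_mul _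
    have hval : T ^ (p - q) / (q - p) = ∫ x in Ioi T, x ^ (p - 1 - q) := by
      rw [integral_Ioi_rpow_of_lt (by linarith) hT0, show p - 1 - q + 1 = -(q - p) by ring,
        neg_div_neg_eq, neg_sub]
    rw [hval, ← integral_const_mul, ofReal_integral_eq_lintegral_ofReal hi]
    · refine setLIntegral_mono' measurableSet_Ioi fun x hx => ?_
      have hx0 : 0 < x := hT0.trans hx
      have hx1 : ¬ x ≤ 1 := not_le.2 (hT.trans_lt hx)
      rw [hg]
      simp only [tailBound, abs_of_pos hx0, if_neg hx1]
      rw [← ENNReal.ofReal_mul (Real.rpow_nonneg hx0.le _)]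
      refine ENNReal.ofReal_le_ofReal ?_
      calc _ ≤ x ^ (p - 1) * (2 * (M / x ^ q)) := by
            gcongr
            exact min_le_right _ _
        _ = 2 * M * (x ^ (p - 1) / x ^ q) := by ring
        _ = _ := by rw [← Real.rpow_sub hx0]
    · refine (ae_restrict_iff' measurableSet_Ioi).2 (ae_of_all _ fun x hx => ?_)
      have hx0 : 0 < x := hT0.trans hx
      simp only [Pi.zero_apply]; positivity
  gcongr
  rw [← Ioc_union_Ioi_eq_Ioi (zero_le_one' ℝ), ← Ioc_union_Ioi_eq_Ioi hT]
  refine (lintegral_union_le _ _ _).trans ?_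
  rw [add_assoc]
  exact add_le_add h1 ((lintegral_union_le _ _ _).trans (add_le_add h2 h3))

lemma exists_lintegral_tailBound_le {p q : ℝ} (hp : 1 ≤ p) (hpq : p < q) :
    ∃ D : ℝ, 0 ≤ D ∧ ∀ n : ℕ, 1 ≤ n → (q = 2 * p → 2 ≤ n) → ∀ M : ℝ, 0 ≤ M →
    ∫⁻ x, ENNReal.ofReal (|x| ^ (p - 1)) *
      ENNReal.ofReal (min √(tailBound q M x / n) (2 * tailBound q M x)) ≤
    ENNReal.ofReal (D * (1 + M) * rate p q n ^ p) := by
  obtain ⟨D, hD, h⟩ := exists_le_rate_rpow hp hpq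
  have hqp : 0 < q - p := by linarith
  refine ⟨2 * (D * (2 + 2 / (q - p))), by positivity, fun n hn hn2 M hM => ?_⟩
  obtain ⟨h1, h2, h3⟩ := h n hn hn2
  have hq : 0 < q := by linarith
  have hn1 : (1 : ℝ) ≤ n := by exact_mod_cast hn
  refine (lintegral_tailBound_le hp hpq hM
    (Real.one_le_rpow hn1 (one_div_nonneg.2 hq.le)) hn).trans (ENNReal.ofReal_le_ofReal ?_)
  -- This makes the final bound linear in `1 + M`.
  have hsM : √M ≤ 1 + M := by
    rw [Real.sqrt_le_left (by linarith)]; nlinarith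
  have hsM0 := Real.sqrt_nonneg M
  set ρ := D * rate p q n ^ p with hρ
  have hρ0 : 0 ≤ ρ := mul_nonneg hD (Real.rpow_nonneg (rate_nonneg p q n) p)
  calc _ ≤ 2 * (ρ * (1 + M) + (1 + M) * ρ + 2 * (1 + M) * (ρ / (q - p))) := by
        have h1' : (n : ℝ) ^ (-(1 / 2) : ℝ) ≤ ρ * (1 + M) := by nlinarith
        have h2' := mul_le_mul hsM h2 (mul_nonneg (by positivity) (intervalIntegral.integral_nonneg
          (Real.one_le_rpow hn1 (one_div_nonneg.2 hq.le)) fun x hx =>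
            Real.rpow_nonneg (by linarith [hx.1]) _)) (by linarith)
        have h3' : 2 * M * (((n : ℝ) ^ (1 / q)) ^ (p - q) / (q - p)) ≤
            2 * (1 + M) * (ρ / (q - p)) := by
          gcongr
          linarith
        linarith
    _ = _ := by rw [hρ]; ring

/-! ### Expected one-dimensional error, averaged over a family -/

lemma measureReal_tail_le {α : Type*} [MeasurableSpace α] (μ : Measure α) [IsProbabilityMeasure μ]
    {f : α → ℝ} (hf : Measurable f) {q M : ℝ} (hq : 0 < q) (hM : 0 ≤ M)
    (h : ∫⁻ a, ENNReal.ofReal (|f a| ^ q) ∂μ ≤ ENNReal.ofReal M) (x : ℝ) :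
    μ.real {a | |x| ≤ |f a|} ≤ tailBound q M x := by
  unfold tailBound
  split_ifs with hx
  · exact measureReal_le_one
  · have hx0 : 0 < |x| := by linarith
    have hxq : 0 < |x| ^ q := Real.rpow_pos_of_pos hx0 q
    refine ENNReal.toReal_le_of_le_ofReal (by positivity) ?_
    rw [ENNReal.ofReal_div_of_pos hxq]
    have hm : AEMeasurable (fun a => ENNReal.ofReal (|f a| ^ q)) μ :=
      (ENNReal.measurable_ofReal.comp (hf.norm.pow_const q)).aemeasurable
    refine le_trans (measure_mono fun a ha => ?_) ((meas_ge_le_lintegral_div hm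
      (ENNReal.ofReal_pos.2 hxq).ne' ENNReal.ofReal_ne_top).trans (ENNReal.div_le_div_right h _))
    exact ENNReal.ofReal_le_ofReal (Real.rpow_le_rpow hx0.le ha hq.le)

/-- For `x ≤ 0` the half-line event lies in the tail beyond `|x|`; for `x ≥ 0` its complement does.
-/
lemma lintegral_abs_empirical_Iic_sub_le {α : Type*} [MeasurableSpace α] (μ : Measure α)
    [IsProbabilityMeasure μ] {f : α → ℝ} (hf : Measurable f) {q M : ℝ} (hq : 0 < q) (hM : 0 ≤ M)
    (h : ∫⁻ a, ENNReal.ofReal (|f a| ^ q) ∂μ ≤ ENNReal.ofReal M) {n : ℕ} (hn : 1 ≤ n) (x : ℝ) :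
    ∫⁻ y, ENNReal.ofReal |(empirical y).real {a | f a ≤ x} - μ.real {a | f a ≤ x}|
      ∂(Measure.pi fun _ : Fin n => μ) ≤
    ENNReal.ofReal (min √(tailBound q M x / n) (2 * tailBound q M x)) := by
  refine lintegral_abs_empirical_sub_le hn μ (measurableSet_le hf measurable_const) ?_
  have ht := measureReal_tail_le μ hf hq hM h x
  rcases le_total x 0 with hx | hx
  · refine Or.inl (le_trans (measureReal_mono fun a ha => ?_) ht)
    simp only [mem_ofPred_eq] at ha ⊢
    rw [abs_of_nonpos hx, abs_of_nonpos (ha.trans hx)]; linarith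
  · refine Or.inr (le_trans (measureReal_mono fun a ha => ?_) ht)
    simp only [mem_compl_iff, mem_ofPred_eq, not_le] at ha ⊢
    rw [abs_of_nonneg hx, abs_of_nonneg (hx.trans ha.le)]; linarith

lemma measurable_empirical_sub {α T : Type*} [MeasurableSpace α] [MeasurableSpace T]
    (μ : Measure α) [IsProbabilityMeasure μ] {S : T → α → ℝ}
    (hS : Measurable (Function.uncurry S)) {n : ℕ} :
    Measurable fun z : (Fin n → α) × (T × ℝ) =>
      (empirical z.1).real {a | S z.2.1 a ≤ z.2.2} - μ.real {a | S z.2.1 a ≤ z.2.2} := by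
  have hset : ∀ z : T × ℝ, MeasurableSet {a | S z.1 a ≤ z.2} := fun z =>
    measurableSet_le (hS.comp measurable_prodMk_left) measurable_const
  refine Measurable.sub ?_ ?_
  · simp only [empirical_real_apply _ (hset _)]
    refine (Finset.measurable_sum _ fun i _ => ?_).const_mul _
    have : MeasurableSet {z : (Fin n → α) × (T × ℝ) | S z.2.1 (z.1 i) ≤ z.2.2} :=
      measurableSet_le (hS.comp ((measurable_fst.comp measurable_snd).prodMk
        ((measurable_pi_apply i).comp measurable_fst))) (measurable_snd.comp measurable_snd)
    exact (measurable_const (a := (1 : ℝ))).indicator this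
  · have : MeasurableSet {z : (T × ℝ) × α | S z.1.1 z.2 ≤ z.1.2} :=
      measurableSet_le (hS.comp ((measurable_fst.comp measurable_fst).prodMk measurable_snd))
        (measurable_snd.comp measurable_fst)
    exact ((measurable_measure_prodMk_left (ν := μ) this).ennreal_toReal).comp measurable_snd

/-- Convergence rate of the averaged one-dimensional Wasserstein distances between the images of a
measure and of its empirical measures under a measurable family of real functions. -/
lemma exists_lintegral_wassersteinPow_empirical_le {p q : ℝ} (hp : 1 ≤ p) (hpq : p < q) :
    ∃ D : ℝ, 0 ≤ D ∧ ∀ n : ℕ, 1 ≤ n → (q = 2 * p → 2 ≤ n) → ∀ M : ℝ, 0 ≤ M →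
    ∀ {α T : Type} [MeasurableSpace α] [MeasurableSpace T] (μ : Measure α) (τ : Measure T)
      [IsProbabilityMeasure μ] [IsProbabilityMeasure τ] (S : T → α → ℝ),
      Measurable (Function.uncurry S) →
      (∀ t, ∫⁻ a, ENNReal.ofReal (|S t a| ^ q) ∂μ ≤ ENNReal.ofReal M) →
    ∃ U : (Fin n → α) → ℝ≥0∞, Measurable U ∧
      (∀ y, ∫⁻ t, wassersteinPow p absMetric ((empirical y).map (S t)) (μ.map (S t)) ∂τ ≤ U y) ∧
      ∫⁻ y, U y ∂(Measure.pi fun _ => μ) ≤ ENNReal.ofReal (D * (1 + M) * rate p q n ^ p) := by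
  obtain ⟨D, hD, hDn⟩ := exists_lintegral_tailBound_le hp hpq
  refine ⟨2 ^ p * p * D, by positivity, fun n hn hn2 M hM α T _ _ μ τ _ _ S hS hSq => ?_⟩
  have hSt : ∀ t, Measurable (S t) := fun t => hS.comp measurable_prodMk_left
  set d : (Fin n → α) → T × ℝ → ℝ := fun y z =>
    (empirical y).real {a | S z.1 a ≤ z.2} - μ.real {a | S z.1 a ≤ z.2} with hd
  have hdm : Measurable fun z : (Fin n → α) × (T × ℝ) => d z.1 z.2 := measurable_empirical_sub μ hS
  set w : ℝ → ℝ≥0∞ := fun x => ENNReal.ofReal (|x| ^ (p - 1)) with hw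
  have hwm : Measurable w := ENNReal.measurable_ofReal.comp (measurable_norm.pow_const _)
  have hdn : Measurable fun z : (Fin n → α) × (T × ℝ) => ENNReal.ofReal |d z.1 z.2| :=
    ENNReal.measurable_ofReal.comp (measurable_norm.comp hdm)
  have hwn : Measurable fun z : (Fin n → α) × (T × ℝ) => w z.2.2 :=
    hwm.comp (measurable_snd.comp measurable_snd)
  have hFm : Measurable (Function.uncurry fun (y : Fin n → α) (z : T × ℝ) =>
      w z.2 * ENNReal.ofReal |d y z|) := hwn.mul hdn
  have hFy : ∀ y, Measurable fun z : T × ℝ => w z.2 * ENNReal.ofReal |d y z| := fun y =>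
    hFm.of_uncurry_left
  have hmain : ∫⁻ y, ∫⁻ z, w z.2 * ENNReal.ofReal |d y z| ∂(τ.prod volume)
      ∂(Measure.pi fun _ : Fin n => μ) ≤ ENNReal.ofReal (D * (1 + M) * rate p q n ^ p) := by
    -- Bringing the expectation innermost lets the pointwise estimate act at fixed `t` and `x`; its
    -- bound is uniform in `t`.
    rw [lintegral_lintegral_swap hFm.aemeasurable]
    have hsw : Measurable fun z : T × ℝ =>
        ∫⁻ y, w z.2 * ENNReal.ofReal |d y z| ∂(Measure.pi fun _ : Fin n => μ) :=
      Measurable.lintegral_prod_left hFm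
    rw [lintegral_prod _ hsw.aemeasurable]
    calc _ ≤ ∫⁻ _t, ENNReal.ofReal (D * (1 + M) * rate p q n ^ p) ∂τ := by
          refine lintegral_mono fun t => le_trans (lintegral_mono fun x => ?_) (hDn n hn hn2 M hM)
          simp only
          rw [lintegral_const_mul' _ _ ENNReal.ofReal_ne_top]
          gcongr
          exact lintegral_abs_empirical_Iic_sub_le μ (hSt t) (by linarith) hM (hSq t) hn x
      _ = _ := by simp
  -- The majorant is the explicit cdf integral, whose measurability in the sample follows from
  -- Tonelli.
  refine ⟨fun y => ENNReal.ofReal (2 ^ p * p) *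
    ∫⁻ z, w z.2 * ENNReal.ofReal |d y z| ∂(τ.prod volume), ?_, fun y => ?_, ?_⟩
  · exact (Measurable.lintegral_prod_right hFm).const_mul _
  · have := isProbabilityMeasure_empirical hn y
    beta_reduce
    rw [lintegral_prod _ (hFy y).aemeasurable, ← lintegral_const_mul' _ _ ENNReal.ofReal_ne_top]
    refine lintegral_mono fun t => ?_
    have := Measure.isProbabilityMeasure_map (μ := empirical y) (hSt t).aemeasurable
    have := Measure.isProbabilityMeasure_map (μ := μ) (hSt t).aemeasurable
    refine (wassersteinPow_le_lintegral_cdf hp _ _).trans (le_of_eq ?_)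
    simp only [cdf_eq_real, map_measureReal_apply (hSt t) measurableSet_Iic]
    rfl
  · calc _ = ENNReal.ofReal (2 ^ p * p) * ∫⁻ y, ∫⁻ z, w z.2 * ENNReal.ofReal |d y z|
          ∂(τ.prod volume) ∂(Measure.pi fun _ : Fin n => μ) :=
        lintegral_const_mul' _ _ ENNReal.ofReal_ne_top
      _ ≤ ENNReal.ofReal (2 ^ p * p) * ENNReal.ofReal (D * (1 + M) * rate p q n ^ p) :=
        mul_le_mul' le_rfl hmain
      _ = _ := by rw [← ENNReal.ofReal_mul (by positivity)]; congr 1; ring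

/-! ### Metric properties of the Wasserstein distance on the line -/

/-- The Wasserstein distance of order `p` on the line. -/
noncomputable def wassersteinDist (p : ℝ) (α β : Measure ℝ) : ℝ≥0∞ :=
  wassersteinPow p absMetric α β ^ (1 / p)

lemma coe_absMetric (x y : ℝ) : (absMetric x y : ℝ≥0∞) = edist x y := by
  rw [edist_nndist, Real.nndist_eq, absMetric]

lemma wassersteinPow_eq (p : ℝ) (α β : Measure ℝ) :
    wassersteinPow p absMetric α β = ⨅ π ∈ couplings α β, ∫⁻ z, edist z.1 z.2 ^ p ∂π := by
  simp only [wassersteinPow, coe_absMetric]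

lemma wassersteinDist_rpow {p : ℝ} (hp : 1 ≤ p) (α β : Measure ℝ) :
    wassersteinDist p α β ^ p = wassersteinPow p absMetric α β := by
  rw [wassersteinDist, ← ENNReal.rpow_mul, one_div_mul_cancel (by linarith), ENNReal.rpow_one]

lemma wassersteinDist_eq {p : ℝ} (hp : 1 ≤ p) (α β : Measure ℝ) :
    wassersteinDist p α β =
      ⨅ π ∈ couplings α β, (∫⁻ z, edist z.1 z.2 ^ p ∂π) ^ (1 / p) := by
  have h : 0 < 1 / p := one_div_pos.2 (by linarith)
  have := fun (π : Measure (ℝ × ℝ)) => (ENNReal.orderIsoRpow (1 / p) h).map_iInf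
    (fun _ : π ∈ couplings α β => ∫⁻ z, edist z.1 z.2 ^ p ∂π)
  rw [wassersteinDist, wassersteinPow_eq]
  refine ((ENNReal.orderIsoRpow (1 / p) h).map_iInf _).trans (iInf_congr fun π => ?_)
  exact this π

lemma measurable_edist_rpow (p : ℝ) : Measurable fun z : ℝ × ℝ => edist z.1 z.2 ^ p :=
  (measurable_edist).pow_const p

/-- The joint law of `f` and `g` is a coupling. This is the source of stability in the direction and
in the sample. -/
lemma wassersteinDist_map_le {α : Type*} [MeasurableSpace α] {p : ℝ} (hp : 1 ≤ p) (μ : Measure α)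
    {f g : α → ℝ} (hf : Measurable f) (hg : Measurable g) :
    wassersteinDist p (μ.map f) (μ.map g) ≤ (∫⁻ a, edist (f a) (g a) ^ p ∂μ) ^ (1 / p) := by
  rw [wassersteinDist_eq hp]
  have hmem : μ.map (fun a => (f a, g a)) ∈ couplings (μ.map f) (μ.map g) := by
    constructor
    · rw [Measure.map_map measurable_fst (hf.prodMk hg)]; rfl
    · rw [Measure.map_map measurable_snd (hf.prodMk hg)]; rfl
  refine (iInf₂_le _ hmem).trans (le_of_eq ?_)
  rw [lintegral_map (measurable_edist_rpow p) (hf.prodMk hg)]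

lemma wassersteinPow_comm (p : ℝ) (α β : Measure ℝ) :
    wassersteinPow p absMetric α β = wassersteinPow p absMetric β α := by
  have key : ∀ α β : Measure ℝ,
      wassersteinPow p absMetric α β ≤ wassersteinPow p absMetric β α := fun α β => by
    rw [wassersteinPow_eq, wassersteinPow_eq]
    refine le_iInf₂ fun π hπ => ?_
    have hmem : π.map Prod.swap ∈ couplings α β := by
      constructor
      · rw [Measure.map_map measurable_fst measurable_swap]; exact hπ.2
      · rw [Measure.map_map measurable_snd measurable_swap]; exact hπ.1
    refine (iInf₂_le _ hmem).trans (le_of_eq ?_)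
    rw [lintegral_map (measurable_edist_rpow p) measurable_swap]
    simp only [Prod.fst_swap, Prod.snd_swap, edist_comm]
  exact le_antisymm (key α β) (key β α)

lemma wassersteinDist_comm (p : ℝ) (α β : Measure ℝ) :
    wassersteinDist p α β = wassersteinDist p β α := by
  rw [wassersteinDist, wassersteinPow_comm, wassersteinDist]

/-- **Gluing lemma**: two couplings with a common marginal are marginals of one measure. -/
lemma exists_gluing {α β γ : Measure ℝ} [IsProbabilityMeasure β] {π₁ π₂ : Measure (ℝ × ℝ)}
    (h₁ : π₁ ∈ couplings α β) (h₂ : π₂ ∈ couplings β γ) :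
    ∃ ρ : Measure (ℝ × ℝ × ℝ), ρ.map (fun w => (w.2.1, w.1)) = π₁ ∧
      ρ.map (fun w => (w.1, w.2.2)) = π₂ := by
  have hfst₁ : (π₁.map Prod.swap).fst = β := by
    rw [Measure.fst, Measure.map_map measurable_fst measurable_swap]; exact h₁.2
  have hfst₂ : π₂.fst = β := h₂.1
  have : IsProbabilityMeasure π₂ := by
    have h : IsProbabilityMeasure (π₂.map Prod.fst) := by rw [h₂.1]; infer_instance
    exact (Measure.isProbabilityMeasure_map_iff measurable_fst.aemeasurable).1 h
  have : IsProbabilityMeasure (π₁.map Prod.swap) := by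
    have h : IsProbabilityMeasure ((π₁.map Prod.swap).map Prod.fst) := by
      rw [← Measure.fst, hfst₁]; infer_instance
    exact (Measure.isProbabilityMeasure_map_iff measurable_fst.aemeasurable).1 h
  -- Disintegrate both couplings over `β` and make the outer variables conditionally independent;
  -- the shared variable comes first in the glued triple.
  set κ := (π₁.map Prod.swap).condKernel with hκ
  set η := π₂.condKernel with hη
  have e₁ : β ⊗ₘ κ = π₁.map Prod.swap := by rw [hκ, ← hfst₁]; exact Measure.disintegrate _ _
  have e₂ : β ⊗ₘ η = π₂ := by rw [hη]; nth_rewrite 1 [← hfst₂]; exact Measure.disintegrate _ _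
  refine ⟨β ⊗ₘ (κ ×ₖ η), ?_, ?_⟩
  · have h := Measure.compProd_map (μ := β) (κ := κ ×ₖ η) measurable_fst
    rw [← Kernel.fst_eq, Kernel.fst_prod, e₁] at h
    have h' := congrArg (Measure.map Prod.swap) h
    rw [Measure.map_map measurable_swap measurable_swap, Prod.swap_swap_eq, Measure.map_id,
      Measure.map_map measurable_swap (by fun_prop)] at h'
    exact h'.symm
  · have h := Measure.compProd_map (μ := β) (κ := κ ×ₖ η) measurable_snd
    rw [← Kernel.snd_eq, Kernel.snd_prod, e₂] at h
    exact h.symm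

/-- Glue the couplings and apply Minkowski in `L^p` of the glued measure. -/
lemma wassersteinDist_triangle {p : ℝ} (hp : 1 ≤ p) (α β γ : Measure ℝ)
    [IsProbabilityMeasure β] :
    wassersteinDist p α γ ≤ wassersteinDist p α β + wassersteinDist p β γ := by
  rw [wassersteinDist_eq hp α β, wassersteinDist_eq hp β γ]
  refine ENNReal.le_iInf₂_add_iInf₂ fun π₁ h₁ π₂ h₂ => ?_
  obtain ⟨ρ, hρ₁, hρ₂⟩ := exists_gluing h₁ h₂
  have hα : ρ.map (fun w => w.2.1) = α := by
    rw [← h₁.1, ← hρ₁, Measure.map_map (by fun_prop) (by fun_prop)]; rfl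
  have hγ : ρ.map (fun w => w.2.2) = γ := by
    rw [← h₂.2, ← hρ₂, Measure.map_map (by fun_prop) (by fun_prop)]; rfl
  have m₁ : Measurable fun w : ℝ × ℝ × ℝ => edist w.2.1 w.1 :=
    measurable_edist.comp (f := fun w : ℝ × ℝ × ℝ => (w.2.1, w.1)) (by fun_prop)
  have m₂ : Measurable fun w : ℝ × ℝ × ℝ => edist w.1 w.2.2 :=
    measurable_edist.comp (f := fun w : ℝ × ℝ × ℝ => (w.1, w.2.2)) (by fun_prop)
  calc wassersteinDist p α γ ≤ (∫⁻ w, edist w.2.1 w.2.2 ^ p ∂ρ) ^ (1 / p) := by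
        rw [← hα, ← hγ]
        exact wassersteinDist_map_le hp ρ (by fun_prop) (by fun_prop)
    _ ≤ (∫⁻ w, ((fun w : ℝ × ℝ × ℝ => edist w.2.1 w.1) +
          fun w : ℝ × ℝ × ℝ => edist w.1 w.2.2) w ^ p ∂ρ) ^ (1 / p) := by
        gcongr with w
        exact edist_triangle _ _ _
    _ ≤ _ := ENNReal.lintegral_Lp_add_le m₁.aemeasurable m₂.aemeasurable hp
    _ = _ := by
        rw [← hρ₁, ← hρ₂, lintegral_map (measurable_edist_rpow p) (by fun_prop),
          lintegral_map (measurable_edist_rpow p) (by fun_prop)]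

/-! ### Averaging over a family of slices -/

section Sliced

variable {α T : Type*} [MeasurableSpace α] [MeasurableSpace T]

/-- The sliced Wasserstein distance with respect to a family `S` of real functions, averaged over
the parameter. -/
noncomputable def slicedDist (p : ℝ) (S : T → α → ℝ) (τ : Measure T) (μ ν : Measure α) : ℝ≥0∞ :=
  (∫⁻ t, wassersteinPow p absMetric (μ.map (S t)) (ν.map (S t)) ∂τ) ^ (1 / p)

lemma slicedDist_comm (p : ℝ) (S : T → α → ℝ) (τ : Measure T) (μ ν : Measure α) :
    slicedDist p S τ μ ν = slicedDist p S τ ν μ := by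
  simp only [slicedDist, wassersteinPow_comm p (μ.map _)]

lemma slicedDist_eq {p : ℝ} (hp : 1 ≤ p) (S : T → α → ℝ) (τ : Measure T) (μ ν : Measure α) :
    slicedDist p S τ μ ν =
      (∫⁻ t, wassersteinDist p (μ.map (S t)) (ν.map (S t)) ^ p ∂τ) ^ (1 / p) := by
  simp only [slicedDist, wassersteinDist_rpow hp]

lemma rpow_lintegral_const_le {p : ℝ} (hp : 1 ≤ p) (μ : Measure α) [IsProbabilityMeasure μ]
    (c : ℝ≥0∞) : (∫⁻ _a, c ^ p ∂μ) ^ (1 / p) = c := by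
  rw [lintegral_const, measure_univ, mul_one, ← ENNReal.rpow_mul, mul_one_div_cancel (by linarith),
    ENNReal.rpow_one]

variable {p : ℝ} {S : T → α → ℝ} {τ : Measure T}

lemma slicedDist_le_of_forall_le (hp : 1 ≤ p) [IsProbabilityMeasure τ] {μ ν : Measure α}
    {c : ℝ≥0∞} (h : ∀ t, wassersteinDist p (μ.map (S t)) (ν.map (S t)) ≤ c) :
    slicedDist p S τ μ ν ≤ c := by
  rw [slicedDist_eq hp]
  refine le_trans ?_ (rpow_lintegral_const_le hp τ c).le
  gcongr with t
  exact h t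

/-- Minkowski over the parameter, on top of the one-dimensional triangle inequality; this is where
measurability of the slice distances is required. -/
lemma slicedDist_triangle (hp : 1 ≤ p) (hS : ∀ t, Measurable (S t)) {μ ν ξ : Measure α}
    [IsProbabilityMeasure ν]
    (h₁ : Measurable fun t => wassersteinDist p (μ.map (S t)) (ν.map (S t)))
    (h₂ : Measurable fun t => wassersteinDist p (ν.map (S t)) (ξ.map (S t))) :
    slicedDist p S τ μ ξ ≤ slicedDist p S τ μ ν + slicedDist p S τ ν ξ := by
  simp only [slicedDist_eq hp]
  refine le_trans ?_ (ENNReal.lintegral_Lp_add_le h₁.aemeasurable h₂.aemeasurable hp)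
  gcongr with t
  have := Measure.isProbabilityMeasure_map (μ := ν) (hS t).aemeasurable
  exact wassersteinDist_triangle hp _ _ _

/-- Moving `t` displaces each image measure by at most the `L^p` norm of `b` times `edist s t`, so
the function is Lipschitz, hence continuous. -/
lemma measurable_wassersteinDist [PseudoEMetricSpace T] [OpensMeasurableSpace T] (hp : 1 ≤ p)
    (hS : ∀ t, Measurable (S t)) {b : α → ℝ≥0∞}
    (hb : ∀ s t a, edist (S s a) (S t a) ≤ b a * edist s t)
    {μ ν : Measure α} [IsProbabilityMeasure μ] [IsProbabilityMeasure ν]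
    (hμ : ∫⁻ a, b a ^ p ∂μ ≠ ∞) (hν : ∫⁻ a, b a ^ p ∂ν ≠ ∞) :
    Measurable fun t => wassersteinDist p (μ.map (S t)) (ν.map (S t)) := by
  have hp0 : 0 ≤ p := by linarith
  have key : ∀ (ξ : Measure α) [IsProbabilityMeasure ξ] (s t : T), edist s t ≠ ∞ →
      wassersteinDist p (ξ.map (S s)) (ξ.map (S t)) ≤
        (∫⁻ a, b a ^ p ∂ξ) ^ (1 / p) * edist s t := fun ξ _ s t hst => by
    refine (wassersteinDist_map_le hp ξ (hS s) (hS t)).trans ?_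
    calc _ ≤ (∫⁻ a, b a ^ p * edist s t ^ p ∂ξ) ^ (1 / p) := by
          gcongr with a
          rw [← ENNReal.mul_rpow_of_nonneg _ _ hp0]
          exact ENNReal.rpow_le_rpow (hb s t a) hp0
      _ = _ := by
          rw [lintegral_mul_const' _ _ (ENNReal.rpow_ne_top_of_nonneg hp0 hst),
            ENNReal.mul_rpow_of_nonneg _ _ (by positivity), ← ENNReal.rpow_mul (edist s t),
            mul_one_div_cancel (by linarith), ENNReal.rpow_one]
  -- The added `1` keeps `C` nonzero, so that `C * ∞ = ∞` for points at infinite distance.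
  set C := (∫⁻ a, b a ^ p ∂μ) ^ (1 / p) + (∫⁻ a, b a ^ p ∂ν) ^ (1 / p) + 1 with hC
  have hCtop : C ≠ ∞ := by
    have h1 := ENNReal.rpow_ne_top_of_nonneg (one_div_nonneg.2 hp0) hμ
    have h2 := ENNReal.rpow_ne_top_of_nonneg (one_div_nonneg.2 hp0) hν
    exact ENNReal.add_ne_top.2 ⟨ENNReal.add_ne_top.2 ⟨h1, h2⟩, ENNReal.one_ne_top⟩
  refine (_root_.continuous_of_le_add_edist C hCtop fun s t => ?_).measurable
  rcases eq_or_ne (edist s t) ∞ with hst | hst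
  · rw [hst, ENNReal.mul_top (by simp [hC])]; simp
  have := fun t => Measure.isProbabilityMeasure_map (μ := μ) (hS t).aemeasurable
  have := fun t => Measure.isProbabilityMeasure_map (μ := ν) (hS t).aemeasurable
  calc wassersteinDist p (μ.map (S s)) (ν.map (S s))
      ≤ wassersteinDist p (μ.map (S s)) (μ.map (S t)) +
        (wassersteinDist p (μ.map (S t)) (ν.map (S t)) +
          wassersteinDist p (ν.map (S t)) (ν.map (S s))) :=
        (wassersteinDist_triangle hp _ (μ.map (S t)) _).trans
          (add_le_add le_rfl (wassersteinDist_triangle hp _ (ν.map (S t)) _))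
    _ ≤ (∫⁻ a, b a ^ p ∂μ) ^ (1 / p) * edist s t +
        (wassersteinDist p (μ.map (S t)) (ν.map (S t)) +
          (∫⁻ a, b a ^ p ∂ν) ^ (1 / p) * edist s t) := by
        gcongr
        · exact key μ s t hst
        · rw [wassersteinDist_comm]; exact key ν s t hst
    _ ≤ wassersteinDist p (μ.map (S t)) (ν.map (S t)) + C * edist s t := by
        rw [hC, add_mul, add_mul, add_left_comm, add_assoc]
        gcongr
        exact le_self_add

/-- Each slice is compared with the Dirac mass at `0`, uniformly in the parameter. -/
lemma slicedDist_ne_top [IsProbabilityMeasure τ] (hp : 1 ≤ p)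
    (hS : ∀ t, Measurable (S t)) {b : α → ℝ≥0∞} (hb : ∀ t a, edist (S t a) 0 ≤ b a)
    {μ ν : Measure α} [IsProbabilityMeasure μ] [IsProbabilityMeasure ν]
    (hμ : ∫⁻ a, b a ^ p ∂μ ≠ ∞) (hν : ∫⁻ a, b a ^ p ∂ν ≠ ∞) :
    slicedDist p S τ μ ν ≠ ∞ := by
  have hp0 : 0 ≤ p := by linarith
  have key : ∀ (ξ : Measure α) [IsProbabilityMeasure ξ] (t : T),
      wassersteinDist p (ξ.map (S t)) (Measure.dirac 0) ≤ (∫⁻ a, b a ^ p ∂ξ) ^ (1 / p) := by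
    intro ξ _ t
    have h0 : ξ.map (fun _ => (0 : ℝ)) = Measure.dirac 0 := by simp [Measure.map_const]
    rw [← h0]
    refine (wassersteinDist_map_le hp ξ (hS t) measurable_const).trans ?_
    gcongr with a
    exact hb t a
  have h1 := ENNReal.rpow_ne_top_of_nonneg (one_div_nonneg.2 hp0) hμ
  have h2 := ENNReal.rpow_ne_top_of_nonneg (one_div_nonneg.2 hp0) hν
  refine ne_top_of_le_ne_top (ENNReal.add_ne_top.2 ⟨h1, h2⟩)
    (slicedDist_le_of_forall_le hp fun t => ?_)
  refine (wassersteinDist_triangle hp _ (Measure.dirac 0) _).trans (add_le_add (key μ t) ?_)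
  rw [wassersteinDist_comm]
  exact key ν t

/-- Pair the `i`-th points: both slices are images of the uniform measure on the indices. -/
lemma slicedDist_empirical_le [PseudoEMetricSpace α] [IsProbabilityMeasure τ] (hp : 1 ≤ p)
    (hS : ∀ t, Measurable (S t)) {C : ℝ≥0} (hC : ∀ t, LipschitzWith C (S t)) {n : ℕ} (hn : 1 ≤ n)
    (x y : Fin n → α) :
    slicedDist p S τ (empirical x) (empirical y) ≤ C * edist x y := by
  have hp0 : 0 ≤ p := by linarith
  refine slicedDist_le_of_forall_le hp fun t => ?_
  have hid : ∀ z : Fin n → α, (empirical z).map (S t) =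
      (empirical (id : Fin n → Fin n)).map fun i => S t (z i) := fun z => by
    rw [map_empirical z (hS t), map_empirical id (measurable_of_finite _)]
    rfl
  have := isProbabilityMeasure_empirical hn (id : Fin n → Fin n)
  rw [hid, hid]
  refine (wassersteinDist_map_le hp _ (measurable_of_finite _) (measurable_of_finite _)).trans ?_
  refine le_trans ?_ (rpow_lintegral_const_le hp (empirical (id : Fin n → Fin n)) _).le
  gcongr with i
  refine (hC t (x i) (y i)).trans ?_
  gcongr
  exact edist_le_pi_edist x y i

lemma lintegral_rpow_empirical_ne_top (hp : 1 ≤ p) {b : α → ℝ≥0∞} (hb : Measurable b)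
    (hbtop : ∀ a, b a ≠ ∞) {n : ℕ} (hn : 1 ≤ n) (x : Fin n → α) :
    ∫⁻ a, b a ^ p ∂(empirical x) ≠ ∞ := by
  rw [lintegral_empirical x (hb.pow_const p)]
  refine ENNReal.mul_ne_top (by simp; omega) (ENNReal.sum_ne_top.2 fun i _ => ?_)
  exact ENNReal.rpow_ne_top_of_nonneg (by linarith) (hbtop _)

/-- Jensen for `x ↦ x^(1/p)`, as monotonicity of `L^r` norms in `r` on a probability space. -/
lemma lintegral_rpow_one_div_le (hp : 1 ≤ p) (μ : Measure α) [IsProbabilityMeasure μ]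
    {f : α → ℝ≥0∞} (hf : Measurable f) :
    ∫⁻ a, f a ^ (1 / p) ∂μ ≤ (∫⁻ a, f a ∂μ) ^ (1 / p) := by
  have h := eLpNorm'_le_eLpNorm'_of_exponent_le one_pos hp μ
    (hf.pow_const (1 / p)).aestronglyMeasurable
  simpa [eLpNorm', ← ENNReal.rpow_mul, inv_mul_cancel₀ (show p ≠ 0 by linarith)] using h

end Sliced

/-! ### Linear and circular defining functions -/

/-- The radius of a defining function, with the value `0` for a linear one. -/
def Kind.radius : Kind → ℝ≥0
  | .linear => 0
  | .circular r => r

namespace Kind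

variable (k : Kind) {d : ℕ}

lemma continuous_toFun : Continuous fun z : E d × Sph d => k.toFun z.1 z.2 := by
  cases k <;> simp only [toFun] <;> fun_prop

lemma norm_coe_sph (θ : Sph d) : ‖(θ : E d)‖ = 1 := by simp

lemma abs_toFun_le (x : E d) (θ : Sph d) : |k.toFun x θ| ≤ ‖x‖ + k.radius := by
  cases k with
  | linear =>
    have := abs_real_inner_le_norm x (θ : E d)
    simpa [toFun, radius] using this
  | circular r =>
    have := norm_sub_le x ((r : ℝ) • (θ : E d))
    rw [norm_smul, norm_coe_sph, mul_one, Real.norm_of_nonneg r.coe_nonneg] at this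
    simpa [toFun, radius] using this

/-- The Lipschitz constant in the direction is `‖x‖` for a linear function and `r` for a circular
one; the sum covers both. -/
lemma abs_toFun_sub_dir_le (x : E d) (θ θ' : Sph d) :
    |k.toFun x θ - k.toFun x θ'| ≤ (‖x‖ + k.radius) * dist θ θ' := by
  have hd : dist θ θ' = ‖(θ : E d) - θ'‖ := by rw [Subtype.dist_eq, dist_eq_norm]
  rw [hd]
  cases k with
  | linear =>
    have := abs_real_inner_le_norm x ((θ : E d) - θ')
    simpa [toFun, radius, inner_sub_right] using this
  | circular r =>
    have := abs_norm_sub_norm_le (x - (r : ℝ) • (θ : E d)) (x - (r : ℝ) • (θ' : E d))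
    rw [sub_sub_sub_cancel_left, ← smul_sub, norm_smul, Real.norm_of_nonneg r.coe_nonneg,
      norm_sub_rev (θ' : E d)] at this
    simp only [toFun, radius]
    refine this.trans ?_
    gcongr
    exact le_add_of_nonneg_left (norm_nonneg x)

lemma abs_toFun_sub_le (x y : E d) (θ : Sph d) : |k.toFun x θ - k.toFun y θ| ≤ ‖x - y‖ := by
  cases k with
  | linear =>
    have := abs_real_inner_le_norm (x - y) (θ : E d)
    simpa [toFun, inner_sub_left] using this
  | circular r =>
    have := abs_norm_sub_norm_le (x - (r : ℝ) • (θ : E d)) (y - (r : ℝ) • (θ : E d))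
    rwa [sub_sub_sub_cancel_right] at this

end Kind

lemma abs_coe_sph_apply_le {d : ℕ} (ψ : Sph d) (i : Fin d) : |(ψ : E d) i| ≤ 1 := by
  have := PiLp.norm_apply_le (ψ : E d) i
  rwa [Kind.norm_coe_sph, Real.norm_eq_abs] at this

lemma abs_coe_sph_apply_sub_le {d : ℕ} (ψ ψ' : Sph d) (i : Fin d) :
    |(ψ : E d) i - (ψ' : E d) i| ≤ dist ψ ψ' := by
  have := PiLp.norm_apply_le ((ψ : E d) - (ψ' : E d)) i
  rwa [Subtype.dist_eq, dist_eq_norm, ← Real.norm_eq_abs, ← PiLp.sub_apply]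

/-- Normalization needs a nonzero surface measure; in dimension `0` the sphere is empty. -/
lemma isProbabilityMeasure_uniformSphere {d : ℕ} (hd : 1 ≤ d) :
    IsProbabilityMeasure (uniformSphere d) := by
  have : Nonempty (Fin d) := ⟨⟨0, hd⟩⟩
  have h0 : (volume : Measure (E d)).toSphere univ ≠ 0 := by
    rw [Ne, Measure.measure_univ_eq_zero]
    exact Measure.toSphere_ne_zero _
  exact ⟨by rw [uniformSphere, Measure.smul_apply, smul_eq_mul,
    ENNReal.inv_mul_cancel h0 (measure_ne_top _ _)]⟩

/-! ### Bounds on the slicing map, uniform in the directions -/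

section Slice

variable (k₁ k₂ : Kind) {d₁ d₂ : ℕ}

/-- The slicing map as a family of functions indexed by the triple of directions. -/
noncomputable def sliceFamily (k₁ k₂ : Kind) {d₁ d₂ : ℕ} (t : Sph d₁ × Sph d₂ × Sph 2)
    (x : E d₁ × E d₂) : ℝ :=
  slice k₁.toFun k₂.toFun t.1 t.2.1 t.2.2 x

/-- The uniform distribution of the triple of directions. -/
noncomputable def uniformDirections (d₁ d₂ : ℕ) : Measure (Sph d₁ × Sph d₂ × Sph 2) :=
  (uniformSphere d₁).prod ((uniformSphere d₂).prod (uniformSphere 2))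

lemma isProbabilityMeasure_uniformDirections (h₁ : 1 ≤ d₁) (h₂ : 1 ≤ d₂) :
    IsProbabilityMeasure (uniformDirections d₁ d₂) := by
  have := isProbabilityMeasure_uniformSphere h₁
  have := isProbabilityMeasure_uniformSphere h₂
  have := isProbabilityMeasure_uniformSphere one_le_two
  unfold uniformDirections
  infer_instance

/-- A bound for the absolute value of every slice of `x`. -/
noncomputable def sliceBound (k₁ k₂ : Kind) {d₁ d₂ : ℕ} (x : E d₁ × E d₂) : ℝ :=
  (‖x.1‖ + k₁.radius) + (‖x.2‖ + k₂.radius)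

lemma sliceBound_nonneg (x : E d₁ × E d₂) : 0 ≤ sliceBound k₁ k₂ x := by
  unfold sliceBound; positivity

lemma measurable_sliceBound : Measurable (sliceBound k₁ k₂ : E d₁ × E d₂ → ℝ) := by
  unfold sliceBound; fun_prop

lemma measurable_uncurry_sliceFamily :
    Measurable (Function.uncurry (sliceFamily k₁ k₂ : Sph d₁ × Sph d₂ × Sph 2 → _ → ℝ)) := by
  have h1 : Continuous fun z : (Sph d₁ × Sph d₂ × Sph 2) × (E d₁ × E d₂) =>
      k₁.toFun z.2.1 z.1.1 := k₁.continuous_toFun.comp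
    (f := fun z : (Sph d₁ × Sph d₂ × Sph 2) × (E d₁ × E d₂) => (z.2.1, z.1.1)) (by fun_prop)
  have h2 : Continuous fun z : (Sph d₁ × Sph d₂ × Sph 2) × (E d₁ × E d₂) =>
      k₂.toFun z.2.2 z.1.2.1 := k₂.continuous_toFun.comp
    (f := fun z : (Sph d₁ × Sph d₂ × Sph 2) × (E d₁ × E d₂) => (z.2.2, z.1.2.1)) (by fun_prop)
  have h3 : ∀ i : Fin 2, Continuous fun z : (Sph d₁ × Sph d₂ × Sph 2) × (E d₁ × E d₂) =>
      (z.1.2.2 : E 2) i := fun i => by fun_prop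
  exact (((h3 0).mul h1).add ((h3 1).mul h2)).measurable

lemma measurable_sliceFamily (t : Sph d₁ × Sph d₂ × Sph 2) :
    Measurable (sliceFamily k₁ k₂ t) :=
  (measurable_uncurry_sliceFamily k₁ k₂).of_uncurry_left

lemma abs_sliceFamily_le (t : Sph d₁ × Sph d₂ × Sph 2) (x : E d₁ × E d₂) :
    |sliceFamily k₁ k₂ t x| ≤ sliceBound k₁ k₂ x := by
  refine (abs_add_le _ _).trans (add_le_add ?_ ?_) <;> rw [abs_mul]
  · exact (mul_le_of_le_one_left (abs_nonneg _) (abs_coe_sph_apply_le _ _)).trans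
      (k₁.abs_toFun_le _ _)
  · exact (mul_le_of_le_one_left (abs_nonneg _) (abs_coe_sph_apply_le _ _)).trans
      (k₂.abs_toFun_le _ _)

lemma abs_coord_mul_sub_le {d : ℕ} (k : Kind) (ψ ψ' : Sph 2) (i : Fin 2) (θ θ' : Sph d) (x : E d)
    {δ : ℝ} (hψ : dist ψ ψ' ≤ δ) (hθ : dist θ θ' ≤ δ) :
    |(ψ : E 2) i * k.toFun x θ - (ψ' : E 2) i * k.toFun x θ'| ≤ 2 * (‖x‖ + k.radius) * δ := by
  -- Change the direction first and the weight second; each change contributes one copy of `(‖x‖ +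
  -- radius) * δ`.
  have e : (ψ : E 2) i * k.toFun x θ - (ψ' : E 2) i * k.toFun x θ' =
      (ψ : E 2) i * (k.toFun x θ - k.toFun x θ') +
        ((ψ : E 2) i - (ψ' : E 2) i) * k.toFun x θ' := by ring
  have hr : 0 ≤ ‖x‖ + (k.radius : ℝ) := by positivity
  rw [e]
  refine (abs_add_le _ _).trans ?_
  rw [abs_mul, abs_mul]
  have h1 : |(ψ : E 2) i| * |k.toFun x θ - k.toFun x θ'| ≤ (‖x‖ + k.radius) * δ :=
    (mul_le_of_le_one_left (abs_nonneg _) (abs_coe_sph_apply_le _ _)).trans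
      ((k.abs_toFun_sub_dir_le x θ θ').trans (by gcongr))
  have h2 : |(ψ : E 2) i - (ψ' : E 2) i| * |k.toFun x θ'| ≤ δ * (‖x‖ + k.radius) :=
    mul_le_mul ((abs_coe_sph_apply_sub_le ψ ψ' i).trans hψ) (k.abs_toFun_le x θ') (abs_nonneg _)
      (dist_nonneg.trans hψ)
  linarith

lemma abs_sliceFamily_sub_dir_le (s t : Sph d₁ × Sph d₂ × Sph 2) (x : E d₁ × E d₂) :
    |sliceFamily k₁ k₂ s x - sliceFamily k₁ k₂ t x| ≤ 2 * sliceBound k₁ k₂ x * dist s t := by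
  have hs1 : dist s.1 t.1 ≤ dist s t := le_max_left _ _
  have hs2 : dist s.2 t.2 ≤ dist s t := le_max_right _ _
  have hs3 : dist s.2.1 t.2.1 ≤ dist s t := (le_max_left _ _).trans hs2
  have hs4 : dist s.2.2 t.2.2 ≤ dist s t := (le_max_right _ _).trans hs2
  have h1 := abs_coord_mul_sub_le k₁ s.2.2 t.2.2 0 s.1 t.1 x.1 hs4 hs1
  have h2 := abs_coord_mul_sub_le k₂ s.2.2 t.2.2 1 s.2.1 t.2.1 x.2 hs4 hs3
  have e : sliceFamily k₁ k₂ s x - sliceFamily k₁ k₂ t x =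
      ((s.2.2 : E 2) 0 * k₁.toFun x.1 s.1 - (t.2.2 : E 2) 0 * k₁.toFun x.1 t.1) +
      ((s.2.2 : E 2) 1 * k₂.toFun x.2 s.2.1 - (t.2.2 : E 2) 1 * k₂.toFun x.2 t.2.1) := by
    simp only [sliceFamily, slice]; ring
  rw [e]
  refine (abs_add_le _ _).trans ((add_le_add h1 h2).trans (le_of_eq ?_))
  unfold sliceBound; ring

lemma edist_sliceFamily_le (s t : Sph d₁ × Sph d₂ × Sph 2) (x : E d₁ × E d₂) :
    edist (sliceFamily k₁ k₂ s x) (sliceFamily k₁ k₂ t x) ≤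
      ENNReal.ofReal (2 * sliceBound k₁ k₂ x) * edist s t := by
  rw [edist_dist, edist_dist, Real.dist_eq,
    ← ENNReal.ofReal_mul (mul_nonneg (by norm_num) (sliceBound_nonneg k₁ k₂ x))]
  exact ENNReal.ofReal_le_ofReal (abs_sliceFamily_sub_dir_le k₁ k₂ s t x)

/-- The factor 2 is kept so that the majorant agrees with that of `edist_sliceFamily_le`, and one
moment condition serves for finiteness and measurability. -/
lemma edist_sliceFamily_zero_le (t : Sph d₁ × Sph d₂ × Sph 2) (x : E d₁ × E d₂) :
    edist (sliceFamily k₁ k₂ t x) 0 ≤ ENNReal.ofReal (2 * sliceBound k₁ k₂ x) := by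
  rw [edist_dist, Real.dist_eq, sub_zero]
  have := sliceBound_nonneg k₁ k₂ x
  exact ENNReal.ofReal_le_ofReal ((abs_sliceFamily_le k₁ k₂ t x).trans (by linarith))

lemma lipschitzWith_sliceFamily (t : Sph d₁ × Sph d₂ × Sph 2) :
    LipschitzWith 2 (sliceFamily k₁ k₂ t) := by
  refine LipschitzWith.of_dist_le_mul fun x y => ?_
  have e : sliceFamily k₁ k₂ t x - sliceFamily k₁ k₂ t y =
      (t.2.2 : E 2) 0 * (k₁.toFun x.1 t.1 - k₁.toFun y.1 t.1) +
      (t.2.2 : E 2) 1 * (k₂.toFun x.2 t.2.1 - k₂.toFun y.2 t.2.1) := by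
    simp only [sliceFamily, slice]; ring
  have h1 : ‖x.1 - y.1‖ ≤ dist x y := by rw [← dist_eq_norm]; exact le_max_left _ _
  have h2 : ‖x.2 - y.2‖ ≤ dist x y := by rw [← dist_eq_norm]; exact le_max_right _ _
  rw [Real.dist_eq, e]
  refine (abs_add_le _ _).trans ?_
  rw [abs_mul, abs_mul]
  have h3 := (mul_le_of_le_one_left (abs_nonneg _) (abs_coe_sph_apply_le t.2.2 0)).trans
    ((k₁.abs_toFun_sub_le x.1 y.1 t.1).trans h1)
  have h4 := (mul_le_of_le_one_left (abs_nonneg _) (abs_coe_sph_apply_le t.2.2 1)).trans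
    ((k₂.abs_toFun_sub_le x.2 y.2 t.2.1).trans h2)
  refine (add_le_add h3 h4).trans (le_of_eq ?_)
  push_cast; ring

lemma jointNorm_nonneg (x : E d₁ × E d₂) : 0 ≤ jointNorm x := Real.sqrt_nonneg _

/-- The slice bound is at most `2J + R`, hence at most twice the larger of `2J` and `R`. -/
lemma sliceBound_rpow_le {q : ℝ} (hq : 0 ≤ q) (x : E d₁ × E d₂) :
    sliceBound k₁ k₂ x ^ q ≤
      4 ^ q * jointNorm x ^ q + 2 ^ q * ((k₁.radius : ℝ) + k₂.radius) ^ q := by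
  have hJ := jointNorm_nonneg x
  have h1 : ‖x.1‖ ≤ jointNorm x :=
    Real.le_sqrt_of_sq_le (le_add_of_nonneg_right (sq_nonneg _))
  have h2 : ‖x.2‖ ≤ jointNorm x :=
    Real.le_sqrt_of_sq_le (le_add_of_nonneg_left (sq_nonneg _))
  set R : ℝ := (k₁.radius : ℝ) + k₂.radius with hR
  have hR0 : 0 ≤ R := by positivity
  have hle : sliceBound k₁ k₂ x ≤ 2 * jointNorm x + R := by unfold sliceBound; linarith
  have h4 : (4 : ℝ) ^ q * jointNorm x ^ q = (4 * jointNorm x) ^ q :=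
    (Real.mul_rpow (by norm_num) hJ).symm
  have h5 : (2 : ℝ) ^ q * R ^ q = (2 * R) ^ q := (Real.mul_rpow (by norm_num) hR0).symm
  rw [h4, h5]
  rcases le_total (2 * jointNorm x) R with h | h
  · refine (Real.rpow_le_rpow (sliceBound_nonneg k₁ k₂ x) (show _ ≤ 2 * R by linarith) hq).trans ?_
    exact le_add_of_nonneg_left (by positivity)
  · refine (Real.rpow_le_rpow (sliceBound_nonneg k₁ k₂ x)
      (show _ ≤ 4 * jointNorm x by linarith) hq).trans ?_
    exact le_add_of_nonneg_right (by positivity)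

lemma lintegral_sliceBound_rpow_le {q : ℝ} (hq : 0 ≤ q) (μ : Measure (E d₁ × E d₂))
    [IsProbabilityMeasure μ] (hμ : FiniteMoment q μ) :
    ∫⁻ x, ENNReal.ofReal (sliceBound k₁ k₂ x ^ q) ∂μ ≤
      ENNReal.ofReal (4 ^ q * moment q μ + 2 ^ q * ((k₁.radius : ℝ) + k₂.radius) ^ q) := by
  have hi : Integrable (fun x => (4 : ℝ) ^ q * jointNorm x ^ q +
      2 ^ q * ((k₁.radius : ℝ) + k₂.radius) ^ q) μ := (hμ.const_mul _).add (integrable_const _)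
  have hval : 4 ^ q * moment q μ + 2 ^ q * ((k₁.radius : ℝ) + k₂.radius) ^ q =
      ∫ x, (4 : ℝ) ^ q * jointNorm x ^ q + 2 ^ q * ((k₁.radius : ℝ) + k₂.radius) ^ q ∂μ := by
    rw [integral_add (hμ.const_mul _) (integrable_const _), integral_const_mul]
    simp [moment]
  rw [hval, ofReal_integral_eq_lintegral_ofReal hi (ae_of_all _ fun x => ?_)]
  · exact lintegral_mono fun x => ENNReal.ofReal_le_ofReal (sliceBound_rpow_le k₁ k₂ hq x)
  · have := jointNorm_nonneg x
    simp only [Pi.zero_apply]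
    positivity

/-- Finite `q`-th moments suffice because `b^p ≤ 1 + b^q` for `b ≥ 0`. -/
lemma lintegral_two_mul_sliceBound_rpow_ne_top {p q : ℝ} (hp : 1 ≤ p) (hpq : p < q)
    (μ : Measure (E d₁ × E d₂)) [IsProbabilityMeasure μ] (hμ : FiniteMoment q μ) :
    ∫⁻ x, ENNReal.ofReal (2 * sliceBound k₁ k₂ x) ^ p ∂μ ≠ ∞ := by
  have hle : ∀ x : E d₁ × E d₂, ENNReal.ofReal (2 * sliceBound k₁ k₂ x) ^ p ≤
      ENNReal.ofReal (2 ^ p) * (1 + ENNReal.ofReal (sliceBound k₁ k₂ x ^ q)) := fun x => by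
    have h0 := sliceBound_nonneg k₁ k₂ x
    rw [ENNReal.ofReal_rpow_of_nonneg (by positivity) (by linarith), ← ENNReal.ofReal_one,
      ← ENNReal.ofReal_add zero_le_one (by positivity), ← ENNReal.ofReal_mul (by positivity),
      Real.mul_rpow (by norm_num) h0]
    refine ENNReal.ofReal_le_ofReal (mul_le_mul_of_nonneg_left ?_ (by positivity))
    rcases le_total (sliceBound k₁ k₂ x) 1 with h | h
    · have := Real.rpow_le_one h0 h (show 0 ≤ p by linarith)
      have : 0 ≤ sliceBound k₁ k₂ x ^ q := by positivity
      linarith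
    · have := Real.rpow_le_rpow_of_exponent_le h hpq.le
      linarith
  refine ne_top_of_le_ne_top ?_ (lintegral_mono hle)
  rw [lintegral_const_mul' _ _ ENNReal.ofReal_ne_top, lintegral_add_left measurable_const]
  refine ENNReal.mul_ne_top ENNReal.ofReal_ne_top (ENNReal.add_ne_top.2 ⟨by simp, ?_⟩)
  exact ne_top_of_le_ne_top ENNReal.ofReal_ne_top
    (lintegral_sliceBound_rpow_le k₁ k₂ (by linarith) μ hμ)

lemma lintegral_abs_sliceFamily_rpow_le {q : ℝ} (hq : 0 ≤ q) (μ : Measure (E d₁ × E d₂))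
    [IsProbabilityMeasure μ] (hμ : FiniteMoment q μ) (t : Sph d₁ × Sph d₂ × Sph 2) :
    ∫⁻ x, ENNReal.ofReal (|sliceFamily k₁ k₂ t x| ^ q) ∂μ ≤
      ENNReal.ofReal (4 ^ q * moment q μ + 2 ^ q * ((k₁.radius : ℝ) + k₂.radius) ^ q) :=
  (lintegral_mono fun x => ENNReal.ofReal_le_ofReal
    (Real.rpow_le_rpow (abs_nonneg _) (abs_sliceFamily_le k₁ k₂ t x) hq)).trans
    (lintegral_sliceBound_rpow_le k₁ k₂ hq μ hμ)

end Slice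

/-! ### Comparison with the moment sum -/

lemma moment_nonneg {d₁ d₂ : ℕ} (k : ℝ) (μ : Measure (E d₁ × E d₂)) : 0 ≤ moment k μ :=
  integral_nonneg fun x => Real.rpow_nonneg (jointNorm_nonneg x) k

/-- All terms are nonnegative. The term `i = 0` equals `2 C^q`, as both masses are 1, and `q^q ≥ 1`
handles the term `i = q`. -/
lemma le_momentSum {d₁ d₂ : ℕ} {q C : ℝ} (hq : 1 ≤ q) (hC : 0 ≤ C) (μ ν : Measure (E d₁ × E d₂))
    [IsProbabilityMeasure μ] [IsProbabilityMeasure ν] :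
    2 * C ^ q + (moment q μ + moment q ν) ≤ momentSum q C μ ν := by
  have hq0 : 0 ≤ q := by linarith
  unfold momentSum
  refine add_le_add ?_ ?_
  · have h0 : 0 ∈ Finset.range ⌈q⌉₊ := by
      rw [Finset.mem_range, Nat.ceil_pos]; linarith
    refine le_trans (le_of_eq ?_) (Finset.single_le_sum (fun i _ => ?_) h0)
    · simp only [CharP.cast_eq_zero, Real.rpow_zero, sub_zero, moment, integral_const,
        probReal_univ, smul_eq_mul]
      ring
    · have := moment_nonneg (i : ℝ) μ
      have := moment_nonneg (i : ℝ) ν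
      positivity
  · exact le_mul_of_one_le_left (add_nonneg (moment_nonneg q μ) (moment_nonneg q ν))
      (Real.one_le_rpow hq hq0)

lemma ofReal_abs_toReal_sub_le {a b c : ℝ≥0∞} (ha : a ≠ ∞) (hb : b ≠ ∞) (h₁ : a ≤ b + c)
    (h₂ : b ≤ a + c) : ENNReal.ofReal |a.toReal - b.toReal| ≤ c := by
  rcases eq_or_ne c ∞ with rfl | hc
  · exact le_top
  refine ENNReal.ofReal_le_of_le_toReal (abs_le.2 ⟨?_, ?_⟩)
  · have := ENNReal.toReal_mono (ENNReal.add_ne_top.2 ⟨ha, hc⟩) h₂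
    rw [ENNReal.toReal_add ha hc] at this; linarith
  · have := ENNReal.toReal_mono (ENNReal.add_ne_top.2 ⟨hb, hc⟩) h₁
    rw [ENNReal.toReal_add hb hc] at this; linarith

/-! ### The hybrid distance as a sliced distance -/

/-- The integrability that makes the sliced distances of `μ` finite: the slices are dominated by a
function with finite `p`-th moment. -/
def HasSliceMoment (p : ℝ) (k₁ k₂ : Kind) {d₁ d₂ : ℕ} (μ : Measure (E d₁ × E d₂)) : Prop :=
  ∫⁻ x, ENNReal.ofReal (2 * sliceBound k₁ k₂ x) ^ p ∂μ ≠ ∞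

section

variable {p : ℝ} {k₁ k₂ : Kind} {d₁ d₂ n : ℕ}

lemma hasSliceMoment_empirical (hp : 1 ≤ p) (hn : 1 ≤ n) (x : Fin n → E d₁ × E d₂) :
    HasSliceMoment p k₁ k₂ (empirical x) :=
  lintegral_rpow_empirical_ne_top hp
    (ENNReal.measurable_ofReal.comp ((measurable_sliceBound k₁ k₂).const_mul 2))
    (fun _ => ENNReal.ofReal_ne_top) hn x

/-- By definition `h2sw` is `slicedDist` for `sliceFamily` and `uniformDirections`, so the general
results apply directly. -/
lemma h2sw_ne_top (hp : 1 ≤ p) (h₁ : 1 ≤ d₁) (h₂ : 1 ≤ d₂) {μ ν : Measure (E d₁ × E d₂)}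
    [IsProbabilityMeasure μ] [IsProbabilityMeasure ν]
    (hμ : HasSliceMoment p k₁ k₂ μ) (hν : HasSliceMoment p k₁ k₂ ν) :
    h2sw p absMetric k₁.toFun k₂.toFun μ ν ≠ ∞ := by
  have := isProbabilityMeasure_uniformDirections h₁ h₂
  exact slicedDist_ne_top (τ := uniformDirections d₁ d₂) hp (measurable_sliceFamily k₁ k₂) (edist_sliceFamily_zero_le k₁ k₂) hμ hν

lemma h2sw_comm (μ ν : Measure (E d₁ × E d₂)) :
    h2sw p absMetric k₁.toFun k₂.toFun μ ν = h2sw p absMetric k₁.toFun k₂.toFun ν μ :=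
  slicedDist_comm _ _ _ _ _

lemma h2sw_triangle (hp : 1 ≤ p) {μ ν ξ : Measure (E d₁ × E d₂)}
    [IsProbabilityMeasure μ] [IsProbabilityMeasure ν] [IsProbabilityMeasure ξ]
    (hμ : HasSliceMoment p k₁ k₂ μ) (hν : HasSliceMoment p k₁ k₂ ν)
    (hξ : HasSliceMoment p k₁ k₂ ξ) :
    h2sw p absMetric k₁.toFun k₂.toFun μ ξ ≤
      h2sw p absMetric k₁.toFun k₂.toFun μ ν + h2sw p absMetric k₁.toFun k₂.toFun ν ξ :=
  slicedDist_triangle hp (measurable_sliceFamily k₁ k₂)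
    (measurable_wassersteinDist hp (measurable_sliceFamily k₁ k₂)
      (edist_sliceFamily_le k₁ k₂) hμ hν)
    (measurable_wassersteinDist hp (measurable_sliceFamily k₁ k₂)
      (edist_sliceFamily_le k₁ k₂) hν hξ)

/-- Replacing both measures changes the distance by at most the two displacements. -/
lemma h2sw_le_add (hp : 1 ≤ p) {μ ν μ' ν' : Measure (E d₁ × E d₂)}
    [IsProbabilityMeasure μ] [IsProbabilityMeasure ν]
    [IsProbabilityMeasure μ'] [IsProbabilityMeasure ν']
    (hμ : HasSliceMoment p k₁ k₂ μ) (hν : HasSliceMoment p k₁ k₂ ν)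
    (hμ' : HasSliceMoment p k₁ k₂ μ') (hν' : HasSliceMoment p k₁ k₂ ν') :
    h2sw p absMetric k₁.toFun k₂.toFun μ ν ≤ h2sw p absMetric k₁.toFun k₂.toFun μ' ν' +
      (h2sw p absMetric k₁.toFun k₂.toFun μ μ' + h2sw p absMetric k₁.toFun k₂.toFun ν ν') := by
  refine (h2sw_triangle hp hμ hμ' hν).trans
    ((add_le_add le_rfl (h2sw_triangle hp hμ' hν' hν)).trans (le_of_eq ?_))
  rw [h2sw_comm ν' ν]
  ring

lemma h2sw_empirical_le (hp : 1 ≤ p) (h₁ : 1 ≤ d₁) (h₂ : 1 ≤ d₂) (hn : 1 ≤ n)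
    (x y : Fin n → E d₁ × E d₂) :
    h2sw p absMetric k₁.toFun k₂.toFun (empirical x) (empirical y) ≤ 2 * edist x y := by
  have := isProbabilityMeasure_uniformDirections h₁ h₂
  exact slicedDist_empirical_le (τ := uniformDirections d₁ d₂) hp (measurable_sliceFamily k₁ k₂)
    (lipschitzWith_sliceFamily k₁ k₂) hn x y

/-- The distance is 4-Lipschitz in the pair of samples: each sample contributes the Lipschitz
constant 2 of the slices. -/
lemma measurable_h2sw_empirical (hp : 1 ≤ p) (h₁ : 1 ≤ d₁) (h₂ : 1 ≤ d₂) (hn : 1 ≤ n) :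
    Measurable fun z : (Fin n → E d₁ × E d₂) × (Fin n → E d₁ × E d₂) =>
      h2sw p absMetric k₁.toFun k₂.toFun (empirical z.1) (empirical z.2) := by
  refine (continuous_of_le_add_edist 4 (by norm_num) fun z z' => ?_).measurable
  have := fun x : Fin n → E d₁ × E d₂ => isProbabilityMeasure_empirical hn x
  have hm := fun x : Fin n → E d₁ × E d₂ => hasSliceMoment_empirical (k₁ := k₁) (k₂ := k₂) hp hn x
  refine (h2sw_le_add hp (hm z.1) (hm z.2) (hm z'.1) (hm z'.2)).trans ?_
  gcongr
  have e₁ : edist z.1 z'.1 ≤ edist z z' := le_max_left _ _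
  have e₂ : edist z.2 z'.2 ≤ edist z z' := le_max_right _ _
  calc _ ≤ 2 * edist z z' + 2 * edist z z' :=
        add_le_add ((h2sw_empirical_le hp h₁ h₂ hn _ _).trans (by gcongr))
          ((h2sw_empirical_le hp h₁ h₂ hn _ _).trans (by gcongr))
    _ = 4 * edist z z' := by rw [← add_mul]; norm_num

end

/-- Rate of convergence of the empirical measure in the sliced distance, in expectation. -/
lemma exists_lintegral_h2sw_empirical_le {p q : ℝ} (hp : 1 ≤ p) (hpq : p < q) :
    ∃ D : ℝ, 0 ≤ D ∧ ∀ n : ℕ, 1 ≤ n → (q = 2 * p → 2 ≤ n) →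
    ∀ (d₁ d₂ : ℕ), 1 ≤ d₁ → 1 ≤ d₂ → ∀ (k₁ k₂ : Kind) (μ : Measure (E d₁ × E d₂))
      [IsProbabilityMeasure μ], FiniteMoment q μ →
    ∃ V : (Fin n → E d₁ × E d₂) → ℝ≥0∞, Measurable V ∧
      (∀ x, h2sw p absMetric k₁.toFun k₂.toFun (empirical x) μ ≤ V x) ∧
      ∫⁻ x, V x ∂(Measure.pi fun _ => μ) ≤ ENNReal.ofReal ((D * (1 + (4 ^ q * moment q μ +
        2 ^ q * ((k₁.radius : ℝ) + k₂.radius) ^ q))) ^ (1 / p) * rate p q n) := by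
  obtain ⟨D, hD, hDn⟩ := exists_lintegral_wassersteinPow_empirical_le hp hpq
  refine ⟨D, hD, fun n hn hn2 d₁ d₂ h₁ h₂ k₁ k₂ μ _ hμ => ?_⟩
  have hq : 0 ≤ q := by linarith
  have := isProbabilityMeasure_uniformDirections h₁ h₂
  have hmom := moment_nonneg q μ
  obtain ⟨U, hU, hle, hint⟩ := hDn n hn hn2 _ (by positivity) μ (uniformDirections d₁ d₂)
    (sliceFamily k₁ k₂) (measurable_uncurry_sliceFamily k₁ k₂)
    (lintegral_abs_sliceFamily_rpow_le k₁ k₂ hq μ hμ)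
  refine ⟨fun x => U x ^ (1 / p), hU.pow_const _, fun x => ?_, ?_⟩
  · exact ENNReal.rpow_le_rpow (hle x) (by positivity)
  · have hr := rate_nonneg p q n
    refine (lintegral_rpow_one_div_le hp _ hU).trans
      ((ENNReal.rpow_le_rpow hint (by positivity)).trans (le_of_eq ?_))
    rw [ENNReal.ofReal_rpow_of_nonneg (by positivity) (by positivity),
      Real.mul_rpow (by positivity) (by positivity), ← Real.rpow_mul hr,
      mul_one_div_cancel (by linarith), Real.rpow_one]

end H2SW

/-! ### The main estimate -/

theorem proposition4 :
    ∃ Cg : H2SW.Kind → H2SW.Kind → ℝ≥0,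
    ∀ p q : ℝ, 1 ≤ p → p < q →
    ∃ Cpq : ℝ≥0,
    ∀ (d₁ d₂ : ℕ), 1 ≤ d₁ → 1 ≤ d₂ →
    ∀ (k₁ k₂ : H2SW.Kind)
      (μ ν : Measure (H2SW.E d₁ × H2SW.E d₂)) [IsProbabilityMeasure μ] [IsProbabilityMeasure ν],
    H2SW.FiniteMoment q μ → H2SW.FiniteMoment q ν →
    ∀ n : ℕ, 1 ≤ n → (q = 2 * p → 2 ≤ n) →
    ∀ (Ω : Type*) [MeasurableSpace Ω] (P : Measure Ω) [IsProbabilityMeasure P]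
      (X Y : Fin n → Ω → H2SW.E d₁ × H2SW.E d₂),
    iIndepFun X P → (∀ i, HasLaw (X i) μ P) →
    iIndepFun Y P → (∀ i, HasLaw (Y i) ν P) →
    H2SW.h2sw p H2SW.absMetric k₁.toFun k₂.toFun μ ν ≠ ∞ ∧
    (∀ ω, H2SW.h2sw p H2SW.absMetric k₁.toFun k₂.toFun
      (H2SW.empirical fun i => X i ω) (H2SW.empirical fun i => Y i ω) ≠ ∞) ∧
    Integrable (fun ω => |(H2SW.h2sw p H2SW.absMetric k₁.toFun k₂.toFun
      (H2SW.empirical fun i => X i ω) (H2SW.empirical fun i => Y i ω)).toReal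
        - (H2SW.h2sw p H2SW.absMetric k₁.toFun k₂.toFun μ ν).toReal|) P ∧
    ∫ ω, |(H2SW.h2sw p H2SW.absMetric k₁.toFun k₂.toFun
      (H2SW.empirical fun i => X i ω) (H2SW.empirical fun i => Y i ω)).toReal
        - (H2SW.h2sw p H2SW.absMetric k₁.toFun k₂.toFun μ ν).toReal| ∂P ≤
      (Cpq : ℝ) ^ (1 / p) * H2SW.momentSum q (Cg k₁ k₂) μ ν ^ (1 / p) * H2SW.rate p q n := by
  open H2SW in
  -- The summand 1 makes `C^q ≥ 1`, so the term `i = 0` absorbs additive constants as well as powers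
  -- of the radii.
  refine ⟨fun k₁ k₂ => 1 + k₁.radius + k₂.radius, fun p q hp hpq => ?_⟩
  obtain ⟨D, hD, hDn⟩ := exists_lintegral_h2sw_empirical_le hp hpq
  have hp0 : 0 < p := by linarith
  have hq : 1 ≤ q := by linarith
  -- The factor `2^p` becomes 2 after the root and accounts for the two samples; `1`, `2^q` and
  -- `4^q` weight the constant, the radii and the `q`-th moments, each bounded by the moment sum.
  refine ⟨(2 ^ p * (D * (1 + 2 ^ q + 4 ^ q))).toNNReal,
    fun d₁ d₂ h₁ h₂ k₁ k₂ μ ν _ _ hμ hν n hn hn2 Ω _ P _ X Y hX hXμ hY hYν => ?_⟩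
  have hμ' : HasSliceMoment p k₁ k₂ μ :=
    lintegral_two_mul_sliceBound_rpow_ne_top k₁ k₂ hp hpq μ hμ
  have hν' : HasSliceMoment p k₁ k₂ ν :=
    lintegral_two_mul_sliceBound_rpow_ne_top k₁ k₂ hp hpq ν hν
  have hprob := fun x : Fin n → E d₁ × E d₂ => isProbabilityMeasure_empirical hn x
  have hm := fun x : Fin n → E d₁ × E d₂ => hasSliceMoment_empirical (k₁ := k₁) (k₂ := k₂) hp hn x
  have hfin := h2sw_ne_top hp h₁ h₂ hμ' hν'
  have hfine := fun x y : Fin n → E d₁ × E d₂ => h2sw_ne_top hp h₁ h₂ (hm x) (hm y)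
  obtain ⟨V, hV, hVle, hVint⟩ := hDn n hn hn2 d₁ d₂ h₁ h₂ k₁ k₂ μ hμ
  obtain ⟨W, hW, hWle, hWint⟩ := hDn n hn hn2 d₁ d₂ h₁ h₂ k₁ k₂ ν hν
  -- Independence identifies the law of each sample vector with a product measure. The two samples
  -- enter the bound additively, so their joint law plays no role.
  have hXlaw := hX.hasLaw_pi hXμ
  have hYlaw := hY.hasLaw_pi hYν
  set A := D * (1 + (4 ^ q * moment q μ + 2 ^ q * ((k₁.radius : ℝ) + k₂.radius) ^ q)) with hA
  set B := D * (1 + (4 ^ q * moment q ν + 2 ^ q * ((k₁.radius : ℝ) + k₂.radius) ^ q)) with hB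
  set f : Ω → ℝ := fun ω => |(h2sw p absMetric k₁.toFun k₂.toFun
      (empirical fun i => X i ω) (empirical fun i => Y i ω)).toReal
        - (h2sw p absMetric k₁.toFun k₂.toFun μ ν).toReal| with hf
  have hfm : AEStronglyMeasurable f P := by
    have h := (measurable_h2sw_empirical (k₁ := k₁) (k₂ := k₂) hp h₁ h₂ hn).comp_aemeasurable
      (hXlaw.aemeasurable.prodMk hYlaw.aemeasurable)
    exact (h.ennreal_toReal.sub_const _).norm.aestronglyMeasurable
  have hmomμ := moment_nonneg q μ
  have hmomν := moment_nonneg q ν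
  have hA0 : 0 ≤ A := by positivity
  have hB0 : 0 ≤ B := by positivity
  have hr := rate_nonneg p q n
  have hbound : ∫⁻ ω, ENNReal.ofReal (f ω) ∂P ≤
      ENNReal.ofReal (A ^ (1 / p) * rate p q n + B ^ (1 / p) * rate p q n) := by
    calc _ ≤ ∫⁻ ω, V (fun i => X i ω) + W (fun i => Y i ω) ∂P := by
          refine lintegral_mono fun ω => ofReal_abs_toReal_sub_le (hfine _ _) hfin ?_ ?_
          · exact (h2sw_le_add hp (hm _) (hm _) hμ' hν').trans
              (add_le_add le_rfl (add_le_add (hVle _) (hWle _)))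
          · refine (h2sw_le_add hp hμ' hν' (hm fun i => X i ω) (hm fun i => Y i ω)).trans
              (add_le_add le_rfl ?_)
            rw [h2sw_comm μ, h2sw_comm ν]
            exact add_le_add (hVle _) (hWle _)
      _ = ∫⁻ x, V x ∂(Measure.pi fun _ => μ) + ∫⁻ x, W x ∂(Measure.pi fun _ => ν) := by
          have hVX : AEMeasurable (fun ω => V fun i => X i ω) P :=
            hV.comp_aemeasurable hXlaw.aemeasurable
          rw [lintegral_add_left' hVX,
            ← hXlaw.lintegral_comp hV.aemeasurable, ← hYlaw.lintegral_comp hW.aemeasurable]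
      _ ≤ _ := by
          rw [ENNReal.ofReal_add (by positivity) (by positivity)]
          exact add_le_add hVint hWint
  have hf0 : 0 ≤ᵐ[P] f := ae_of_all _ fun ω => abs_nonneg _
  refine ⟨hfin, fun ω => hfine _ _, ⟨hfm, ?_⟩, ?_⟩
  · rw [hasFiniteIntegral_iff_ofReal hf0]
    exact hbound.trans_lt ENNReal.ofReal_lt_top
  · rw [integral_eq_lintegral_of_nonneg_ae hf0 hfm]
    refine (ENNReal.toReal_le_of_le_ofReal (by positivity) hbound).trans ?_
    set R : ℝ := (k₁.radius : ℝ) + k₂.radius with hR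
    have hR0 : 0 ≤ R := by positivity
    have hC : ((1 + k₁.radius + k₂.radius : ℝ≥0) : ℝ) = 1 + R := by push_cast; ring
    rw [hC, Real.coe_toNNReal _ (by positivity)]
    have hM := le_momentSum hq (show 0 ≤ 1 + R by positivity) μ ν
    set M := momentSum q (1 + R) μ ν
    have h1 : 1 ≤ (1 + R) ^ q := Real.one_le_rpow (by linarith) (by linarith)
    have h2 : R ^ q ≤ (1 + R) ^ q := Real.rpow_le_rpow hR0 (by linarith) (by linarith)
    have h2q : (0 : ℝ) < 2 ^ q := by positivity
    have h4q : (0 : ℝ) < 4 ^ q := by positivity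
    have hM0 : 0 ≤ M := by linarith
    have key : A + B ≤ D * (1 + 2 ^ q + 4 ^ q) * M := by
      have : A + B = D * (2 + 2 ^ q * (2 * R ^ q) + 4 ^ q * (moment q μ + moment q ν)) := by
        rw [hA, hB]; ring
      rw [this, mul_assoc]
      refine mul_le_mul_of_nonneg_left ?_ hD
      have e1 : 2 ^ q * (2 * R ^ q) ≤ 2 ^ q * M := by gcongr; linarith
      have e2 : 4 ^ q * (moment q μ + moment q ν) ≤ 4 ^ q * M := by gcongr; linarith
      linarith
    have hAle : A ^ (1 / p) ≤ (D * (1 + 2 ^ q + 4 ^ q) * M) ^ (1 / p) :=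
      Real.rpow_le_rpow hA0 (by linarith) (by positivity)
    have hBle : B ^ (1 / p) ≤ (D * (1 + 2 ^ q + 4 ^ q) * M) ^ (1 / p) :=
      Real.rpow_le_rpow hB0 (by linarith) (by positivity)
    calc _ = (A ^ (1 / p) + B ^ (1 / p)) * rate p q n := by ring
      _ ≤ (2 * (D * (1 + 2 ^ q + 4 ^ q) * M) ^ (1 / p)) * rate p q n := by
          gcongr; linarith
      _ = _ := by
          rw [Real.mul_rpow (by positivity) (by positivity),
            Real.mul_rpow (x := 2 ^ p) (by positivity) (by positivity), ← Real.rpow_mul (by norm_num),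
            mul_one_div_cancel hp0.ne', Real.rpow_one]
          ring
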